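/- Let $d\ge 1$, write points of $\mathbb{R}^d$ as $x=(x_1,x')$ with $x_1\in\mathbb{R}$, $x'\in\mathbb{R}^{d-1}$, and let $(f,g)=\int_{\mathbb{R}^d}f\,\overline{g}\,dx$ be the inner product of $L^2(\mathbb{R}^d)$ (complex-valued functions). Let $\psi:\mathbb{R}^{d-1}\to\mathbb{R}$ define a regular shear flow, i.e. suppose that $\psi(x')>\ell>0$ for all $x'$ and $|\psi(x')-\psi(y')|\le L|x'-y'|$ for all $x',y'$, where $L\ge 0$. Then the operator $-i\psi(x')\frac{\partial}{\partial x_1}$ with domain $C_0^\infty(\mathbb{R}^d)$ is essentially self-adjoint in $L^2(\mathbb{R}^d)$; denote its closure, which is its unique self-adjoint extension, by $H_1$. It has a spectral family $\{E(\lambda)\}_{\lambda\in\mathbb{R}}$: for each $\lambda$, $E(\lambda)$ is the orthogonal projection onto the largest closed subspace $M$ that reduces $H_1$ (if $P$ is the orthogonal projection onto $M$ and $u\in D(H_1)$, then $Pu\in D(H_1)$ and $H_1Pu=PH_1u$) and satisfies $(H_1u,u)\le\lambda(u,u)$ for all $u\in M\cap D(H_1)$. For $\sigma>\frac12$ let $$\mathcal{X}^\sigma=\Big\{f\in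 L^2(\mathbb{R}^d)\ :\ \|f\|_{\mathcal{X}^\sigma}^2:=\int_{\mathbb{R}^d}(1+x_1^2)^\sigma|f(x)|^2\,dx<\infty\Big\}.$$ Then for all $f,g\in\mathcal{X}^\sigma$ and all $\lambda_0\in\mathbb{R}$ the function $\lambda\mapsto(E(\lambda)f,g)$ is differentiable at $\lambda_0$, and $$\left|\frac{d}{d\lambda}\Big|_{\lambda=\lambda_0}(E(\lambda)f,g)\right|\le C(\sigma,\ell)\left(1+\frac{|\lambda_0|L}{\ell^2}\right)\|f\|_{\mathcal{X}^\sigma}\|g\|_{\mathcal{X}^\sigma},$$ where $C(\sigma,\ell)>0$ depends only on $\sigma$ and $\ell$ (not on $d,\psi,L,\lambda_0,f,g$). -/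

import Mathlib

open MeasureTheory
open scoped NNReal ENNReal Distributions

noncomputable section

namespace ShearFlow

/-! ### Spectral families of (unbounded) operators on a Hilbert space -/

section Spectral

variable {H : Type*} [NormedAddCommGroup H] [InnerProductSpace ℂ H] [CompleteSpace H]

/-- The range of the projection `P` reduces `T`: for every `u ∈ D(T)` one has `P u ∈ D(T)` and
`T P u = P T u`. -/
def Reduces (T : H →ₗ.[ℂ] H) (P : H →L[ℂ] H) : Prop :=
  ∀ u : T.domain, ∃ h : P u ∈ T.domain, T ⟨P u, h⟩ = P (T u)

/-- `P` is an orthogonal projection whose range `M` is a (closed) subspace that reduces `T`, and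
`(T u, u) ≤ μ (u, u)` for all `u ∈ M ∩ D(T)`. (For symmetric `T`, `(T u, u)` is real.) -/
structure IsReducingBelow (T : H →ₗ.[ℂ] H) (μ : ℝ) (P : H →L[ℂ] H) : Prop where
  isStarProjection : IsStarProjection P
  reduces : Reduces T P
  le : ∀ u : T.domain, (u : H) ∈ LinearMap.range P.toLinearMap →
    (inner ℂ (u : H) (T u)).re ≤ μ * ‖(u : H)‖ ^ 2

/-- `E` is the spectral family (resolution of the identity) of `T`: for each real `μ`, `E μ` is the
orthogonal projection onto the largest closed subspace `M` that reduces `T` and satisfies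
`(T u, u) ≤ μ (u, u)` for all `u ∈ M ∩ D(T)`. There is at most one such `E`. -/
def IsSpectralFamily (T : H →ₗ.[ℂ] H) (E : ℝ → H →L[ℂ] H) : Prop :=
  ∀ μ : ℝ, IsReducingBelow T μ (E μ) ∧
    ∀ P : H →L[ℂ] H, IsReducingBelow T μ P →
      LinearMap.range P.toLinearMap ≤ LinearMap.range (E μ).toLinearMap

theorem IsSpectralFamily.unique {T : H →ₗ.[ℂ] H} {E E' : ℝ → H →L[ℂ] H}
    (hE : IsSpectralFamily T E) (hE' : IsSpectralFamily T E') : E = E' := by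
  funext μ
  refine ContinuousLinearMap.IsStarProjection.ext (hE μ).1.isStarProjection
    (hE' μ).1.isStarProjection ?_
  exact le_antisymm ((hE' μ).2 _ (hE μ).1) ((hE μ).2 _ (hE' μ).1)

end Spectral

/-! ### The shear flow operator -/

/-- `ℝ^d` with `d = n + 1`, written as `ℝ × ℝ^(d-1)`: a point is `x = (x₁, x')` and the measure
`volume` is Lebesgue measure (the product of the Lebesgue measures of the factors). -/
abbrev Space (n : ℕ) : Type := ℝ × EuclideanSpace ℝ (Fin n)

/-- The Hilbert space `L²(ℝ^d)`, `d = n + 1`. -/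
abbrev L2 (n : ℕ) : Type := Lp ℂ 2 (volume : Measure (Space n))

/-- The space `C_0^∞(ℝ^d)` of smooth complex functions of compact support. -/
abbrev TestFun (n : ℕ) : Type := 𝓓((⊤ : TopologicalSpace.Opens (Space n)), ℂ)

variable {n : ℕ}

theorem TestFun.memLp (φ : TestFun n) : MemLp φ 2 (volume : Measure (Space n)) :=
  φ.continuous.memLp_of_hasCompactSupport φ.hasCompactSupport

/-- The inclusion `C_0^∞(ℝ^d) → L²(ℝ^d)`. -/
def TestFun.toL2 : TestFun n →ₗ[ℂ] L2 n where
  toFun φ := φ.memLp.toLp φ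
  map_add' _ _ := rfl
  map_smul' _ _ := rfl

theorem TestFun.toL2_injective : Function.Injective (TestFun.toL2 (n := n)) := by
  intro φ χ h
  have h' : (φ : Space n → ℂ) =ᵐ[volume] χ := (MemLp.toLp_eq_toLp_iff φ.memLp χ.memLp).1 h
  exact DFunLike.coe_injective
    ((Continuous.ae_eq_iff_eq volume φ.continuous χ.continuous).1 h')

/-- The function `-i ψ(x') ∂φ/∂x₁`. -/
def shearFun (ψ : EuclideanSpace ℝ (Fin n) → ℝ) (φ : Space n → ℂ) (x : Space n) : ℂ :=
  -Complex.I * (ψ x.2 : ℂ) * fderiv ℝ φ x (1, 0)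

theorem shearFun_memLp {ψ : EuclideanSpace ℝ (Fin n) → ℝ} (hψ : Continuous ψ) (φ : TestFun n) :
    MemLp (shearFun ψ φ) 2 (volume : Measure (Space n)) := by
  have hd : Continuous fun x => fderiv ℝ φ x (1, 0) :=
    (φ.contDiff.continuous_fderiv (by simp)).clm_apply continuous_const
  refine Continuous.memLp_of_hasCompactSupport ?_ ?_
  · unfold shearFun
    fun_prop
  · exact (φ.hasCompactSupport.fderiv_apply ℝ (1, 0)).mul_left

/-- `φ ↦ -i ψ ∂φ/∂x₁` as a linear map `C_0^∞(ℝ^d) → L²(ℝ^d)`. -/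
def shearMap (ψ : EuclideanSpace ℝ (Fin n) → ℝ) (hψ : Continuous ψ) : TestFun n →ₗ[ℂ] L2 n where
  toFun φ := (shearFun_memLp hψ φ).toLp (shearFun ψ φ)
  map_add' φ χ := by
    rw [← MemLp.toLp_add]
    congr 1
    funext x
    have h1 := (φ.contDiff.differentiable (by simp)).differentiableAt (x := x)
    have h2 := (χ.contDiff.differentiable (by simp)).differentiableAt (x := x)
    simp [shearFun, fderiv_add h1 h2]
    ring
  map_smul' c φ := by
    rw [RingHom.id_apply, ← MemLp.toLp_const_smul]
    congr 1
    funext x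
    have h1 := (φ.contDiff.differentiable (by simp)).differentiableAt (x := x)
    simp [shearFun, fderiv_const_smul h1]
    ring

/-- The operator `-i ψ ∂/∂x₁ : C_0^∞(ℝ^d) ⊂ L²(ℝ^d) → L²(ℝ^d)`. -/
def shearFlowCore (ψ : EuclideanSpace ℝ (Fin n) → ℝ) (hψ : Continuous ψ) :
    L2 n →ₗ.[ℂ] L2 n where
  domain := LinearMap.range TestFun.toL2
  toFun := shearMap ψ hψ ∘ₗ
    (LinearEquiv.ofInjective TestFun.toL2 TestFun.toL2_injective).symm.toLinearMap

theorem shearFlowCore_apply (ψ : EuclideanSpace ℝ (Fin n) → ℝ) (hψ : Continuous ψ)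
    (φ : TestFun n) :
    shearFlowCore ψ hψ ⟨TestFun.toL2 φ, ⟨φ, rfl⟩⟩ = shearMap ψ hψ φ :=
  congrArg (shearMap ψ hψ)
    ((LinearEquiv.ofInjective TestFun.toL2 TestFun.toL2_injective).symm_apply_apply φ)

/-- The shear flow operator `H₁ = -i ψ ∂/∂x₁` on `L²(ℝ^d)`: the closure of its restriction to
`C_0^∞(ℝ^d)`. If that restriction is essentially self-adjoint, i.e. if its closure is self-adjoint,
this is its unique self-adjoint extension. -/
def shearFlow (ψ : EuclideanSpace ℝ (Fin n) → ℝ) (hψ : Continuous ψ) : L2 n →ₗ.[ℂ] L2 n :=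
  (shearFlowCore ψ hψ).closure

/-- The conditions on `ψ` for a regular shear flow: `ψ > ℓ > 0` everywhere, and `ψ` is globally
Lipschitz with constant `L`. -/
structure IsRegularShear (ψ : EuclideanSpace ℝ (Fin n) → ℝ) (ℓ : ℝ) (L : ℝ≥0) : Prop where
  ell_pos : 0 < ℓ
  ell_lt : ∀ x', ℓ < ψ x'
  lipschitz : LipschitzWith L ψ

theorem IsRegularShear.continuous {ψ : EuclideanSpace ℝ (Fin n) → ℝ} {ℓ : ℝ} {L : ℝ≥0}
    (h : IsRegularShear ψ ℓ L) : Continuous ψ :=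
  h.lipschitz.continuous

/-! ### The weighted spaces `X^σ` -/

/-- `f ∈ X^σ`, i.e. `∫ (1 + x₁²)^σ |f(x)|² dx < ∞`. -/
def MemX (σ : ℝ) (f : L2 n) : Prop :=
  Integrable (fun x : Space n => (1 + x.1 ^ 2) ^ σ * ‖f x‖ ^ 2) volume

/-- The norm of `X^σ`: `‖f‖² = ∫ (1 + x₁²)^σ |f(x)|² dx`. -/
def normX (σ : ℝ) (f : L2 n) : ℝ :=
  √(∫ x : Space n, (1 + x.1 ^ 2) ^ σ * ‖f x‖ ^ 2)

end ShearFlow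

end

/-! The Fourier transform in `x₁` alone, written `V`, leaves functions of `x'` untouched, so it
turns `-iψ(x')∂/∂x₁` into multiplication by the real symbol `a(ξ, y) = 2πξψ(y)`. Every claim is then
read off from a multiplication operator.

Self-adjointness: the adjoint of the operator on test functions is exactly the maximal
multiplication operator by `a` (`isDiagonal_adjoint_shearFlowCore`). This adjoint is symmetric, and
it extends the original operator, hence it is the closure and is self-adjoint
(`closure_eq_adjoint_of_symmetric`).

Spectral family: for a maximal multiplication operator, `E(λ)` is multiplication by the indicator of
`{a ≤ λ}`. Maximality among reducing subspaces rests on the fact that a reducing projection commutes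
with the cutoffs to `{|a - c| ≤ k}` (`IsDiagonal.isSpectralFamily`).

Derivative: since `ψ > 0`, `(E(λ)f, g)` is the integral over `y` of `∫ f̂ ĝ* dξ` over `ξ ≤
λ/(2πψ(y))`, where `f̂ = Vf`, `ĝ = Vg` and `*` is conjugation. For `σ > 1/2` the weight puts almost
every slice of `f` and `g` in `L¹(ℝ)`, so `f̂` and `ĝ` are continuous and bounded in `ξ`.
Differentiating under the integral gives `∫ (f̂ ĝ*)(λ/(2πψ(y)), y) / (2πψ(y)) dy`, and
Cauchy–Schwarz in `y` bounds it by `weightConst σ / (2πℓ)` times the two weighted norms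
(`hasDerivAt_inner_cutoff`). This bound is uniform in `λ`; the factor `1 + |λ₀|L/ℓ²` only weakens
it. -/

noncomputable section

open Filter Topology
open scoped FourierTransform ContDiff ComplexConjugate

namespace ShearFlow

/-! ### Projections given by indicator functions -/

section Cutoff

variable {α : Type*} [MeasurableSpace α] {ν : Measure α}

/-- Multiplication by the indicator function of `s` on `L²`. -/
def indicatorL2 (ν : Measure α) {s : Set α} (hs : MeasurableSet s) :
    Lp ℂ 2 ν →L[ℂ] Lp ℂ 2 ν :=
  LinearMap.mkContinuous
    { toFun := fun f => ((Lp.memLp f).indicator hs).toLp _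
      map_add' := fun f g => by
        apply Lp.ext
        filter_upwards [((Lp.memLp (f + g)).indicator hs).coeFn_toLp,
          Lp.coeFn_add (((Lp.memLp f).indicator hs).toLp _) (((Lp.memLp g).indicator hs).toLp _),
          ((Lp.memLp f).indicator hs).coeFn_toLp, ((Lp.memLp g).indicator hs).coeFn_toLp,
          Lp.coeFn_add f g] with x h1 h2 h3 h4 h5
        rw [h1, h2, Pi.add_apply, h3, h4]
        by_cases hx : x ∈ s
        · simpa only [Set.indicator_of_mem hx, Pi.add_apply, Pi.smul_apply] using h5
        · simp [hx]
      map_smul' := fun c f => by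
        apply Lp.ext
        filter_upwards [((Lp.memLp (c • f)).indicator hs).coeFn_toLp,
          Lp.coeFn_smul c (((Lp.memLp f).indicator hs).toLp _),
          ((Lp.memLp f).indicator hs).coeFn_toLp,
          Lp.coeFn_smul c f] with x h1 h2 h3 h5
        rw [h1, RingHom.id_apply, h2, Pi.smul_apply, h3]
        by_cases hx : x ∈ s
        · simpa only [Set.indicator_of_mem hx, Pi.add_apply, Pi.smul_apply] using h5
        · simp [hx] } 1 (fun f => by
      rw [one_mul]
      refine Lp.norm_le_norm_of_ae_le ?_
      filter_upwards [((Lp.memLp f).indicator hs).coeFn_toLp] with x hx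
      change ‖((Lp.memLp f).indicator hs).toLp _ x‖ ≤ _
      rw [hx]
      exact norm_indicator_le_norm_self _ _)

theorem indicatorL2_coeFn {s : Set α} (hs : MeasurableSet s) (f : Lp ℂ 2 ν) :
    indicatorL2 ν hs f =ᵐ[ν] s.indicator f :=
  ((Lp.memLp f).indicator hs).coeFn_toLp

theorem inner_indicatorL2_left {s : Set α} (hs : MeasurableSet s) (f g : Lp ℂ 2 ν) :
    inner ℂ (indicatorL2 ν hs f) g = inner ℂ f (indicatorL2 ν hs g) := by
  rw [L2.inner_def, L2.inner_def]
  refine integral_congr_ae ?_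
  filter_upwards [indicatorL2_coeFn hs f, indicatorL2_coeFn hs g] with x h1 h2
  rw [h1, h2]
  by_cases hx : x ∈ s <;> simp [hx]

variable {H : Type*} [NormedAddCommGroup H] [InnerProductSpace ℂ H]

/-- The operator on `H` that is multiplication by the indicator function of `s` in the
representation `F`. -/
def cutoff (F : H ≃ₗᵢ[ℂ] Lp ℂ 2 ν) {s : Set α} (hs : MeasurableSet s) : H →L[ℂ] H :=
  (F.symm.toContinuousLinearEquiv : Lp ℂ 2 ν →L[ℂ] H) ∘L indicatorL2 ν hs ∘L
    (F.toContinuousLinearEquiv : H →L[ℂ] Lp ℂ 2 ν)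

theorem map_cutoff (F : H ≃ₗᵢ[ℂ] Lp ℂ 2 ν) {s : Set α} (hs : MeasurableSet s) (u : H) :
    F (cutoff F hs u) = indicatorL2 ν hs (F u) :=
  F.apply_symm_apply _

theorem cutoff_coeFn (F : H ≃ₗᵢ[ℂ] Lp ℂ 2 ν) {s : Set α} (hs : MeasurableSet s) (u : H) :
    F (cutoff F hs u) =ᵐ[ν] s.indicator (F u) := by
  rw [map_cutoff]
  exact indicatorL2_coeFn hs _

theorem eq_of_map_ae (F : H ≃ₗᵢ[ℂ] Lp ℂ 2 ν) {u v : H} (h : F u =ᵐ[ν] F v) : u = v :=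
  F.injective (Lp.ext h)

theorem cutoff_eq_self (F : H ≃ₗᵢ[ℂ] Lp ℂ 2 ν) {s : Set α} (hs : MeasurableSet s) {u : H}
    (h : ∀ᵐ x ∂ν, x ∉ s → F u x = 0) : cutoff F hs u = u := by
  apply eq_of_map_ae F
  filter_upwards [cutoff_coeFn F hs u, h] with x h1 h2
  rw [h1]
  by_cases hx : x ∈ s
  · simp [hx]
  · simp [hx, h2 hx]

theorem cutoff_cutoff (F : H ≃ₗᵢ[ℂ] Lp ℂ 2 ν) {s : Set α} (hs : MeasurableSet s) (u : H) :
    cutoff F hs (cutoff F hs u) = cutoff F hs u := by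
  apply cutoff_eq_self
  filter_upwards [cutoff_coeFn F hs u] with x h1 hx
  simp [h1, hx]

theorem inner_cutoff_left (F : H ≃ₗᵢ[ℂ] Lp ℂ 2 ν) {s : Set α} (hs : MeasurableSet s) (u v : H) :
    inner ℂ (cutoff F hs u) v = inner ℂ u (cutoff F hs v) := by
  rw [← F.inner_map_map, ← F.inner_map_map u, map_cutoff, map_cutoff, inner_indicatorL2_left]

variable [CompleteSpace H]

theorem isStarProjection_cutoff (F : H ≃ₗᵢ[ℂ] Lp ℂ 2 ν) {s : Set α} (hs : MeasurableSet s) :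
    IsStarProjection (cutoff F hs) where
  isIdempotentElem := ContinuousLinearMap.ext fun u => cutoff_cutoff F hs u
  isSelfAdjoint := by
    rw [ContinuousLinearMap.isSelfAdjoint_iff_isSymmetric]
    exact fun u v => inner_cutoff_left F hs u v

end Cutoff

/-! ### Spectral family of a multiplication operator -/

section Diagonal

variable {α : Type*} [MeasurableSpace α] {ν : Measure α}
variable {H : Type*} [NormedAddCommGroup H] [InnerProductSpace ℂ H]

/-- `T` is unitarily equivalent, via `F`, to the maximal operator of multiplication by `a`. -/
def IsDiagonal (T : H →ₗ.[ℂ] H) (F : H ≃ₗᵢ[ℂ] Lp ℂ 2 ν) (a : α → ℝ) : Prop :=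
  ∀ u w : H, (u, w) ∈ T.graph ↔ ∀ᵐ x ∂ν, (a x : ℂ) * F u x = F w x

theorem LinearPMap.apply_eq_of_mem_graph {T : H →ₗ.[ℂ] H} {u w : H} (h : (u, w) ∈ T.graph) :
    ∃ hu : u ∈ T.domain, T ⟨u, hu⟩ = w := by
  obtain ⟨y, hy, hw⟩ := (LinearPMap.mem_graph_iff T).1 h
  simp only at hy hw
  subst hy
  exact ⟨y.2, hw⟩

theorem reduces_iff_graph {T : H →ₗ.[ℂ] H} {P : H →L[ℂ] H} :
    Reduces T P ↔ ∀ u w, (u, w) ∈ T.graph → (P u, P w) ∈ T.graph := by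
  constructor
  · intro h u w huw
    obtain ⟨hu, rfl⟩ := LinearPMap.apply_eq_of_mem_graph huw
    obtain ⟨hP, hT⟩ := h ⟨u, hu⟩
    rw [← hT]
    exact T.mem_graph ⟨P u, hP⟩
  · intro h u
    exact LinearPMap.apply_eq_of_mem_graph (h u (T u) (T.mem_graph u))

variable {T : H →ₗ.[ℂ] H} {F : H ≃ₗᵢ[ℂ] Lp ℂ 2 ν} {a : α → ℝ}

theorem IsDiagonal.reduces_cutoff (hT : IsDiagonal T F a) {s : Set α} (hs : MeasurableSet s) :
    Reduces T (cutoff F hs) := by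
  rw [reduces_iff_graph]
  intro u w huw
  rw [hT] at huw ⊢
  filter_upwards [huw, cutoff_coeFn F hs u, cutoff_coeFn F hs w] with x h1 h2 h3
  rw [h2, h3]
  by_cases hx : x ∈ s <;> simp [hx, h1]

/-- Quadratic form of a diagonalised operator. -/
theorem IsDiagonal.inner_sub (hT : IsDiagonal T F a) (c : ℝ) {u w : H} (h : (u, w) ∈ T.graph) :
    (inner ℂ u w).re - c * ‖u‖ ^ 2 = ∫ x, (a x - c) * ‖F u x‖ ^ 2 ∂ν := by
  have h1 : (inner ℂ u w).re - c * ‖u‖ ^ 2 = (inner ℂ (F u) (F (w - (c : ℂ) • u))).re := by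
    rw [F.inner_map_map, inner_sub_right, inner_smul_right, inner_self_eq_norm_sq_to_K]
    simp [← Complex.ofReal_pow]
  rw [h1, L2.inner_def]
  change RCLike.re (K := ℂ) _ = _
  rw [← integral_re (L2.integrable_inner (𝕜 := ℂ) _ _)]
  refine integral_congr_ae ?_
  have e1 : F (w - (c : ℂ) • u) = F w - (c : ℂ) • F u := by rw [map_sub, map_smul]
  filter_upwards [(hT u w).1 h, Lp.coeFn_sub (F w) ((c : ℂ) • F u),
    Lp.coeFn_smul (c : ℂ) (F u)] with x h2 h3 h4
  rw [e1, h3, Pi.sub_apply, h4, ← h2]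
  simp only [Pi.smul_apply, smul_eq_mul, ← sub_mul, RCLike.inner_apply]
  rw [mul_assoc, RCLike.mul_conj, ← Complex.ofReal_sub, ← RCLike.ofReal_pow]
  exact Complex.re_ofReal_mul _ _

theorem IsDiagonal.mem_graph_of_bounded (hT : IsDiagonal T F a) (ha : Measurable a) {u : H}
    {C : ℝ} (h : ∀ᵐ x ∂ν, C < |a x| → F u x = 0) : ∃ w, (u, w) ∈ T.graph := by
  have hm : MemLp (fun x => (a x : ℂ) * F u x) 2 ν := by
    refine MemLp.of_le_mul (c := C) (Lp.memLp (F u)) ?_ ?_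
    · exact (Complex.measurable_ofReal.comp ha).aestronglyMeasurable.mul
        (Lp.aestronglyMeasurable _)
    · filter_upwards [h] with x hx
      by_cases h' : C < |a x|
      · simp [hx h']
      · rw [norm_mul, Complex.norm_real, Real.norm_eq_abs]
        gcongr
        exact not_lt.1 h'
  refine ⟨F.symm (hm.toLp _), (hT _ _).2 ?_⟩
  rw [F.apply_symm_apply]
  exact hm.coeFn_toLp.symm

/-- A growth argument. With `b = (a - c)/k`, the vectors `b^m u` stay bounded by `‖u‖` because `|b|
≤ 1` on the support of `u`, while `P` sends them to `b^m P u`. Mass of `P u` on `{|b| ≥ 1 + δ}`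
would make the images grow like `(1 + δ)^m`, against the boundedness of `P`. -/
theorem IsDiagonal.support_of_graph_invariant (hT : IsDiagonal T F a) (ha : Measurable a)
    {P : H →L[ℂ] H} (hP : ∀ u w, (u, w) ∈ T.graph → (P u, P w) ∈ T.graph) {c k : ℝ} (hk : 0 < k)
    {u : H} (hu : ∀ᵐ x ∂ν, k < |a x - c| → F u x = 0) :
    ∀ᵐ x ∂ν, k < |a x - c| → F (P u) x = 0 := by
  have key : ∀ m : ℕ, ∃ v : H, ‖v‖ ≤ ‖u‖ ∧ (∀ᵐ x ∂ν, k < |a x - c| → F v x = 0) ∧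
      ∀ᵐ x ∂ν, F (P v) x = (((a x - c) / k : ℝ) : ℂ) ^ m * F (P u) x := by
    intro m
    induction m with
    | zero => exact ⟨u, le_rfl, hu, by simp⟩
    | succ m ih =>
      obtain ⟨v, hv, hv', hPv⟩ := ih
      obtain ⟨w, hw⟩ := hT.mem_graph_of_bounded ha (u := v) (C := |c| + k) (by
        filter_upwards [hv'] with x hx hx'
        refine hx ?_
        have := abs_sub_abs_le_abs_sub (a x) c
        linarith)
      have hsub : ∀ p q : H, ∀ᵐ x ∂ν, F (((k : ℂ)⁻¹) • (q - (c : ℂ) • p)) x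
          = (k : ℂ)⁻¹ * (F q x - c * F p x) := by
        intro p q
        have e : F (((k : ℂ)⁻¹) • (q - (c : ℂ) • p)) = (k : ℂ)⁻¹ • (F q - (c : ℂ) • F p) := by
          rw [map_smul, map_sub, map_smul]
        rw [e]
        filter_upwards [Lp.coeFn_smul (k : ℂ)⁻¹ (F q - (c : ℂ) • F p),
          Lp.coeFn_sub (F q) ((c : ℂ) • F p), Lp.coeFn_smul (c : ℂ) (F p)] with x h1 h2 h3
        rw [h1, Pi.smul_apply, h2, Pi.sub_apply, h3]
        rfl
      have hw1 := (hT _ _).1 hw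
      have hw2 := (hT _ _).1 (hP _ _ hw)
      refine ⟨((k : ℂ)⁻¹) • (w - (c : ℂ) • v), ?_, ?_, ?_⟩
      · refine le_trans ?_ hv
        rw [← F.norm_map, ← F.norm_map v]
        refine Lp.norm_le_norm_of_ae_le ?_
        filter_upwards [hsub v w, hw1, hv'] with x h1 h2 h3
        rw [h1, ← h2]
        by_cases h' : k < |a x - c|
        · simp [h3 h']
        · have e : (k : ℂ)⁻¹ * ((a x : ℂ) * F v x - c * F v x)
            = (((a x - c) / k : ℝ) : ℂ) * F v x := by push_cast; ring
          rw [e, norm_mul, Complex.norm_real, Real.norm_eq_abs, abs_div, abs_of_pos hk]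
          refine mul_le_of_le_one_left (norm_nonneg _) ?_
          rw [div_le_one hk]
          exact not_lt.1 h'
      · filter_upwards [hsub v w, hw1, hv'] with x h1 h2 h3 h4
        rw [h1, ← h2, h3 h4]
        simp
      · have e : P (((k : ℂ)⁻¹) • (w - (c : ℂ) • v)) = ((k : ℂ)⁻¹) • (P w - (c : ℂ) • P v) := by
          simp
        rw [e]
        filter_upwards [hsub (P v) (P w), hw2, hPv] with x h1 h2 h3
        rw [h1, ← h2, h3, pow_succ]
        push_cast
        ring
  have hlevel : ∀ j : ℕ, ∀ᵐ x ∂ν, 1 + 1 / ((j : ℝ) + 1) ≤ |(a x - c) / k| → F (P u) x = 0 := by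
    intro j
    set δ : ℝ := 1 / ((j : ℝ) + 1) with hδ
    have hδ0 : 0 < δ := by positivity
    have hs : MeasurableSet {x | 1 + δ ≤ |(a x - c) / k|} :=
      measurableSet_le measurable_const (((ha.sub_const c).div_const k).abs)
    have hbd : ∀ m : ℕ, (1 + δ) ^ m * ‖cutoff F hs (P u)‖ ≤ ‖P‖ * ‖u‖ := by
      intro m
      obtain ⟨v, hv, -, hPv⟩ := key m
      calc (1 + δ) ^ m * ‖cutoff F hs (P u)‖
          = ‖F (((1 + δ : ℝ) : ℂ) ^ m • cutoff F hs (P u))‖ := by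
            rw [F.norm_map, norm_smul, norm_pow, Complex.norm_real,
              Real.norm_of_nonneg (by positivity)]
        _ ≤ ‖F (P v)‖ := by
            refine Lp.norm_le_norm_of_ae_le ?_
            rw [map_smul]
            filter_upwards [Lp.coeFn_smul (((1 + δ : ℝ) : ℂ) ^ m) (F (cutoff F hs (P u))),
              cutoff_coeFn F hs (P u), hPv] with x h1 h2 h3
            rw [h1, Pi.smul_apply, h2, h3]
            by_cases hx : 1 + δ ≤ |(a x - c) / k|
            · rw [Set.indicator_of_mem (by exact hx), norm_smul, norm_mul, norm_pow, norm_pow,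
                Complex.norm_real, Complex.norm_real, Real.norm_of_nonneg (by positivity),
                Real.norm_eq_abs]
              gcongr
            · rw [Set.indicator_of_notMem (by exact hx), smul_zero, norm_zero]
              exact norm_nonneg _
        _ ≤ ‖P‖ * ‖v‖ := by rw [F.norm_map]; exact P.le_opNorm v
        _ ≤ ‖P‖ * ‖u‖ := by gcongr
    have hz : cutoff F hs (P u) = 0 := by
      by_contra hne
      have hpos : 0 < ‖cutoff F hs (P u)‖ := norm_pos_iff.2 hne
      obtain ⟨m, hm⟩ := pow_unbounded_of_one_lt (‖P‖ * ‖u‖ / ‖cutoff F hs (P u)‖)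
        (show 1 < 1 + δ by linarith)
      rw [div_lt_iff₀ hpos] at hm
      exact absurd (hbd m) (not_le.2 hm)
    have h0 : F (cutoff F hs (P u)) = 0 := by rw [hz, map_zero]
    filter_upwards [cutoff_coeFn F hs (P u), Lp.coeFn_zero ℂ 2 ν] with x h1 h2 hx
    rw [h0, h2, Set.indicator_of_mem (by exact hx)] at h1
    exact h1.symm
  filter_upwards [ae_all_iff.2 hlevel] with x hx hx'
  have h1 : 1 < |(a x - c) / k| := by
    rw [abs_div, abs_of_pos hk, one_lt_div hk]
    exact hx'
  obtain ⟨j, hj⟩ := exists_nat_one_div_lt (sub_pos.2 h1)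
  exact hx j (by linarith)

variable [CompleteSpace H]

/-- With `Q` the cutoff, invariance of the support gives `QPQ = PQ`. Taking adjoints gives `QPQ =
QP`, so `PQ = QP`. -/
theorem IsDiagonal.commute_cutoff (hT : IsDiagonal T F a) (ha : Measurable a)
    {P : H →L[ℂ] H} (hPsa : IsSelfAdjoint P) (hP : Reduces T P) {c k : ℝ} (hk : 0 < k)
    (hs : MeasurableSet {x | |a x - c| ≤ k}) (u : H) :
    P (cutoff F hs u) = cutoff F hs (P u) := by
  have hsym : ∀ x y : H, inner ℂ (P x) y = inner ℂ x (P y) :=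
    fun x y => (ContinuousLinearMap.isSelfAdjoint_iff_isSymmetric.1 hPsa) x y
  have hpres : ∀ v : H, cutoff F hs (P (cutoff F hs v)) = P (cutoff F hs v) := by
    intro v
    apply cutoff_eq_self
    filter_upwards [hT.support_of_graph_invariant ha (reduces_iff_graph.1 hP) (c := c) hk
      (u := cutoff F hs v) (by
        filter_upwards [cutoff_coeFn F hs v] with x h1 h2
        rw [h1, Set.indicator_of_notMem (by simpa using h2)])] with x h1 h2
    exact h1 (by simpa using h2)
  rw [← hpres u]
  refine ext_inner_right ℂ fun v => ?_
  rw [inner_cutoff_left, hsym, inner_cutoff_left, hpres, ← hsym, ← inner_cutoff_left]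

/-- The spectral family of an operator that is unitarily equivalent to a multiplication operator. -/
theorem IsDiagonal.isSpectralFamily (hT : IsDiagonal T F a) (ha : Measurable a) :
    IsSpectralFamily T fun t => cutoff F (measurableSet_le ha (measurable_const (a := t))) := by
  intro t
  have hst : MeasurableSet {x | a x ≤ t} := measurableSet_le ha measurable_const
  refine ⟨⟨isStarProjection_cutoff F _, hT.reduces_cutoff _, ?_⟩, ?_⟩
  · rintro u ⟨v, hv⟩
    have hv' : cutoff F hst v = u := hv
    rw [← sub_nonpos, hT.inner_sub t (T.mem_graph u)]
    refine integral_nonpos_of_ae ?_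
    filter_upwards [cutoff_coeFn F hst v] with x hx
    rw [hv'] at hx
    rw [hx]
    by_cases h : a x ≤ t
    · exact mul_nonpos_of_nonpos_of_nonneg (by linarith) (by positivity)
    · rw [Set.indicator_of_notMem (by exact h)]
      simp
  · rintro P ⟨hP, hred, hle⟩ u ⟨u', hu'⟩
    have hu : P u = u := by
      rw [← show P u' = u from hu']
      exact congrArg (fun Q : H →L[ℂ] H => Q u') hP.isIdempotentElem
    -- The windows `t + δ ≤ a ≤ t + δ + 2k`, with `δ = 1/(j+1)` and `k = j+1`, exhaust `{a > t}`. On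
    -- each one `a` is bounded, so the cut-off `v` lies in the domain; it stays in the range of `P`,
    -- and its quadratic form is both at least `(t + δ)‖v‖²` and at most `t‖v‖²`.
    have hz : ∀ j : ℕ, ∀ᵐ x ∂ν,
        |a x - (t + 1 / ((j : ℝ) + 1) + ((j : ℝ) + 1))| ≤ (j : ℝ) + 1 → F u x = 0 := by
      intro j
      set δ : ℝ := 1 / ((j : ℝ) + 1) with hδ
      have hδ0 : 0 < δ := by positivity
      set k : ℝ := (j : ℝ) + 1 with hk
      have hk0 : 0 < k := by positivity
      have hs : MeasurableSet {x | |a x - (t + δ + k)| ≤ k} :=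
        measurableSet_le (ha.sub_const _).abs measurable_const
      set v := cutoff F hs u with hv
      have hPv : P v = v := by rw [hv, hT.commute_cutoff ha hP.isSelfAdjoint hred hk0 hs, hu]
      have hvs := cutoff_coeFn F hs u
      obtain ⟨w, hw⟩ := hT.mem_graph_of_bounded ha (u := v) (C := |t + δ + k| + k) (by
        filter_upwards [hvs] with x h1 h2
        rw [h1, Set.indicator_of_notMem]
        intro h3
        have h3' : |a x - (t + δ + k)| ≤ k := h3
        have := abs_sub_abs_le_abs_sub (a x) (t + δ + k)
        linarith)
      have hlow : 0 ≤ (inner ℂ v w).re - (t + δ) * ‖v‖ ^ 2 := by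
        rw [hT.inner_sub (t + δ) hw]
        refine integral_nonneg_of_ae ?_
        filter_upwards [hvs] with x h1
        by_cases h : |a x - (t + δ + k)| ≤ k
        · exact mul_nonneg (by linarith [(abs_le.1 h).1]) (by positivity)
        · rw [h1, Set.indicator_of_notMem (by exact h)]
          simp
      obtain ⟨hvd, rfl⟩ := LinearPMap.apply_eq_of_mem_graph hw
      have hup := hle ⟨v, hvd⟩ ⟨v, hPv⟩
      simp only at hup
      have hv0 : v = 0 := by
        by_contra hne
        have : 0 < ‖v‖ ^ 2 := by positivity
        nlinarith
      have h0 : F v = 0 := by rw [hv0, map_zero]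
      filter_upwards [hvs, Lp.coeFn_zero ℂ 2 ν] with x h1 h2 hx
      rw [h0, h2, Set.indicator_of_mem (by exact hx)] at h1
      exact h1.symm
    refine ⟨u, cutoff_eq_self F _ ?_⟩
    filter_upwards [ae_all_iff.2 hz] with x hx hx'
    have hx'' : 0 < a x - t := by simpa using hx'
    obtain ⟨j, hj⟩ := exists_nat_gt (max (1 / (a x - t)) (a x - t))
    have hj1 : 1 / (a x - t) < j := lt_of_le_of_lt (le_max_left _ _) hj
    have hj2 : a x - t < j := lt_of_le_of_lt (le_max_right _ _) hj
    have h3 : 1 / ((j : ℝ) + 1) < a x - t := by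
      rw [div_lt_iff₀ (by positivity)]
      rw [div_lt_iff₀ hx''] at hj1
      nlinarith
    have h4 : 0 < 1 / ((j : ℝ) + 1) := by positivity
    refine hx j (abs_le.2 ⟨by linarith, by linarith⟩)

end Diagonal

/-! ### The unitary partial Fourier transform -/

section PartialFourier

variable {n : ℕ}

/-- The Fourier transform in the first variable. -/
def partialFourier (f : Space n → ℂ) (p : Space n) : ℂ :=
  𝓕 (fun x : ℝ => f (x, p.2)) p.1

theorem partialFourier_eq_integral (f : Space n → ℂ) (p : Space n) :
    partialFourier f p = ∫ x : ℝ, 𝐞 (-(x * p.1)) • f (x, p.2) :=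
  Real.fourier_real_eq _ _

theorem stronglyMeasurable_partialFourier {f : Space n → ℂ} (hf : StronglyMeasurable f) :
    StronglyMeasurable (partialFourier f) := by
  have h : StronglyMeasurable fun q : Space n × ℝ =>
      𝐞 (-(q.2 * q.1.1)) • f (q.2, q.1.2) := by
    refine StronglyMeasurable.smul (Continuous.stronglyMeasurable ?_)
      (hf.comp_measurable (by fun_prop))
    fun_prop
  have h2 := h.integral_prod_right' (ν := volume)
  rwa [show partialFourier f = _ from funext (partialFourier_eq_integral f)]

theorem norm_partialFourier_le (f : Space n → ℂ) (p : Space n) :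
    ‖partialFourier f p‖ ≤ ∫ x : ℝ, ‖f (x, p.2)‖ := by
  rw [partialFourier_eq_integral]
  refine (norm_integral_le_integral_norm _).trans (le_of_eq ?_)
  simp

theorem hasCompactSupport_slice {f : Space n → ℂ} (hf : HasCompactSupport f)
    (y : EuclideanSpace ℝ (Fin n)) : HasCompactSupport fun x : ℝ => f (x, y) := by
  refine HasCompactSupport.intro (hf.isCompact.image continuous_fst) fun x hx => ?_
  by_contra h
  exact hx ⟨(x, y), subset_tsupport _ h, rfl⟩

/-- The slices of a test function as Schwartz functions of the first variable. -/
def TestFun.slice (φ : TestFun n) (y : EuclideanSpace ℝ (Fin n)) : SchwartzMap ℝ ℂ :=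
  HasCompactSupport.toSchwartzMap (hasCompactSupport_slice φ.hasCompactSupport y)
    (φ.contDiff.comp (contDiff_id.prodMk contDiff_const))

theorem TestFun.slice_apply (φ : TestFun n) (y : EuclideanSpace ℝ (Fin n)) (x : ℝ) :
    φ.slice y x = φ (x, y) := rfl

theorem partialFourier_testFun (φ : TestFun n) (p : Space n) :
    partialFourier φ p = 𝓕 (φ.slice p.2) p.1 := rfl

theorem eLpNorm_two_eq_of_slices {f g : Space n → ℂ} (hf : AEStronglyMeasurable f)
    (hg : AEStronglyMeasurable g)
    (h : ∀ y, eLpNorm (fun x => f (x, y)) 2 (volume : Measure ℝ) =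
      eLpNorm (fun x => g (x, y)) 2 (volume : Measure ℝ)) :
    eLpNorm f 2 = eLpNorm g 2 := by
  have h2 : ∀ y, ∫⁻ x, ‖f (x, y)‖ₑ ^ (2 : ℝ) = ∫⁻ x, ‖g (x, y)‖ₑ ^ (2 : ℝ) := by
    intro y
    have := h y
    rw [eLpNorm_eq_lintegral_rpow_enorm_toReal (by simp) (by simp),
      eLpNorm_eq_lintegral_rpow_enorm_toReal (by simp) (by simp)] at this
    simpa using ENNReal.rpow_left_injective (show (1 / (2 : ℝ)) ≠ 0 by norm_num)
      (by simpa using this)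
  rw [eLpNorm_eq_lintegral_rpow_enorm_toReal (by simp) (by simp),
      eLpNorm_eq_lintegral_rpow_enorm_toReal (by simp) (by simp)]
  congr 1
  simp only [ENNReal.toReal_ofNat]
  rw [Measure.volume_eq_prod, lintegral_prod_symm _ (hf.enorm.pow_const _),
    lintegral_prod_symm _ (hg.enorm.pow_const _)]
  exact lintegral_congr h2

/-- Plancherel holds on each line parallel to the `x₁`-axis; Tonelli integrates it over `y`. -/
theorem eLpNorm_partialFourier (φ : TestFun n) :
    eLpNorm (partialFourier φ) 2 (volume : Measure (Space n)) = eLpNorm φ 2 volume := by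
  refine eLpNorm_two_eq_of_slices
    (stronglyMeasurable_partialFourier φ.continuous.stronglyMeasurable).aestronglyMeasurable
    φ.continuous.aestronglyMeasurable fun y => ?_
  have h := SchwartzMap.norm_fourier_toL2_eq (φ.slice y)
  rw [SchwartzMap.norm_toLp, SchwartzMap.norm_toLp,
    ENNReal.toReal_eq_toReal_iff' ((𝓕 (φ.slice y)).memLp 2 volume).eLpNorm_ne_top
      ((φ.slice y).memLp 2 volume).eLpNorm_ne_top] at h
  exact h

theorem memLp_partialFourier (φ : TestFun n) :
    MemLp (partialFourier φ) 2 (volume : Measure (Space n)) :=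
  ⟨(stronglyMeasurable_partialFourier φ.continuous.stronglyMeasurable).aestronglyMeasurable, by
    rw [eLpNorm_partialFourier]
    exact φ.memLp.eLpNorm_lt_top⟩

/-- The partial Fourier transform of test functions, with values in `L²`. -/
def partialFourierTest : TestFun n →ₗ[ℂ] L2 n where
  toFun φ := (memLp_partialFourier φ).toLp _
  map_add' φ χ := by
    rw [← MemLp.toLp_add]
    congr 1
    funext p
    rw [Pi.add_apply, partialFourier_testFun, partialFourier_testFun, partialFourier_testFun]
    rw [← add_apply, ← FourierTransform.fourier_add]
    rfl
  map_smul' c φ := by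
    rw [RingHom.id_apply, ← MemLp.toLp_const_smul]
    congr 1
    funext p
    rw [Pi.smul_apply, partialFourier_testFun, partialFourier_testFun]
    rw [← smul_apply, ← FourierTransform.fourier_smul]
    rfl

theorem norm_partialFourierTest (φ : TestFun n) :
    ‖partialFourierTest φ‖ = ‖TestFun.toL2 φ‖ := by
  change ‖(memLp_partialFourier φ).toLp _‖ = ‖φ.memLp.toLp _‖
  rw [Lp.norm_toLp, Lp.norm_toLp, eLpNorm_partialFourier]

/-- A smooth compactly supported function as a test function. -/
def TestFun.ofContDiff {f : Space n → ℂ} (h : ContDiff ℝ ∞ f) (h' : HasCompactSupport f) :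
    TestFun n :=
  ⟨f, h, h', fun _ _ => trivial⟩

theorem TestFun.toL2_coeFn (φ : TestFun n) : TestFun.toL2 φ =ᵐ[volume] φ :=
  φ.memLp.coeFn_toLp

theorem partialFourierTest_coeFn (φ : TestFun n) :
    partialFourierTest φ =ᵐ[volume] partialFourier φ :=
  (memLp_partialFourier φ).coeFn_toLp

theorem TestFun.denseRange_toL2 : DenseRange (TestFun.toL2 (n := n)) := by
  refine Dense.mono ?_
    (Lp.dense_hasCompactSupport_contDiff (F := ℂ) (μ := (volume : Measure (Space n)))
      (p := 2) (by simp))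
  rintro f ⟨g, hfg, hg, hg'⟩
  refine ⟨TestFun.ofContDiff hg' hg, Lp.ext ?_⟩
  exact (TestFun.toL2_coeFn _).trans hfg.symm

/-- The partial Fourier transform on `L²` as a continuous linear map. -/
def partialFourierCLM (n : ℕ) : L2 n →L[ℂ] L2 n :=
  LinearMap.extendOfNorm partialFourierTest TestFun.toL2

theorem partialFourierCLM_toL2 (φ : TestFun n) :
    partialFourierCLM n (TestFun.toL2 φ) = partialFourierTest φ :=
  LinearMap.extendOfNorm_eq TestFun.denseRange_toL2
    ⟨1, fun φ => by rw [one_mul, norm_partialFourierTest]⟩ φ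

theorem norm_partialFourierCLM (f : L2 n) : ‖partialFourierCLM n f‖ = ‖f‖ := by
  refine TestFun.denseRange_toL2.induction_on f
    (isClosed_eq (by fun_prop) (by fun_prop)) fun φ => ?_
  rw [partialFourierCLM_toL2, norm_partialFourierTest]

theorem measurePreserving_reflect :
    MeasurePreserving (fun p : Space n => (-p.1, p.2)) volume volume :=
  (Measure.measurePreserving_neg (volume : Measure ℝ)).prod (MeasurePreserving.id _)

/-- Reflection in the first variable. -/
def reflect : L2 n →ₗᵢ[ℂ] L2 n :=
  Lp.compMeasurePreservingₗᵢ ℂ (fun p : Space n => (-p.1, p.2)) measurePreserving_reflect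

theorem reflect_coeFn (f : L2 n) : reflect f =ᵐ[volume] fun p => f (-p.1, p.2) :=
  Lp.coeFn_compMeasurePreserving f measurePreserving_reflect

theorem reflect_partialFourierTest_coeFn (φ : TestFun n) :
    reflect (partialFourierTest φ) =ᵐ[volume] fun p => partialFourier φ (-p.1, p.2) :=
  (reflect_coeFn _).trans
    (measurePreserving_reflect.quasiMeasurePreserving.ae_eq_comp (partialFourierTest_coeFn φ))

/-- The adjoint of the Fourier transform is the transform followed by reflection. This yields both
surjectivity on `L²` and the pointwise formula for the `L²` transform. -/
theorem integral_conj_fourier_mul {f g : ℝ → ℂ} (hf : Integrable f) (hg : Integrable g) :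
    ∫ ξ, conj (𝓕 f ξ) * g ξ = ∫ x, conj (f x) * 𝓕 g (-x) := by
  have h := VectorFourier.integral_sesq_fourierIntegral_eq_neg_flip (innerSL ℂ)
    (L := innerₗ ℝ) Real.continuous_fourierChar continuous_inner hf hg
  have e : ∀ x, VectorFourier.fourierIntegral 𝐞 volume (-(innerₗ ℝ).flip) g x = 𝓕 g (-x) := by
    intro x
    rw [← Real.fourierInv_eq_fourier_neg, Real.fourierInv_eq]
    simp [VectorFourier.fourierIntegral]
  simp only [e] at h
  simpa [mul_comm] using! h

theorem integral_conj_partialFourier_mul {f : Space n → ℂ}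
    (hf : ∀ᵐ y, Integrable fun x : ℝ => f (x, y)) (φ : TestFun n)
    (h1 : Integrable fun p : Space n => conj (partialFourier f p) * φ p)
    (h2 : Integrable fun p : Space n => conj (f p) * partialFourier φ (-p.1, p.2)) :
    ∫ p, conj (partialFourier f p) * φ p =
      ∫ p, conj (f p) * partialFourier φ (-p.1, p.2) := by
  rw [Measure.volume_eq_prod] at h1 h2 ⊢
  rw [integral_prod_symm _ h1, integral_prod_symm _ h2]
  refine integral_congr_ae ?_
  filter_upwards [hf] with y hy
  exact integral_conj_fourier_mul hy (φ.slice y).integrable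

theorem inner_toL2_right (f : L2 n) (φ : TestFun n) :
    inner ℂ f (TestFun.toL2 φ) = ∫ p, conj (f p) * φ p := by
  rw [L2.inner_def]
  refine integral_congr_ae ?_
  filter_upwards [TestFun.toL2_coeFn φ] with p hp
  rw [hp, RCLike.inner_apply, mul_comm]

theorem integrable_conj_mul {f g : Space n → ℂ} (hf : MemLp f 2 volume) (hg : MemLp g 2 volume) :
    Integrable (fun p => conj (f p) * g p) (volume : Measure (Space n)) := by
  refine MemLp.integrable_mul (p := 2) (q := 2) ?_ hg
  exact hf.star

theorem memLp_partialFourier_neg (φ : TestFun n) :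
    MemLp (fun p : Space n => partialFourier φ (-p.1, p.2)) 2 volume :=
  (memLp_partialFourier φ).comp_measurePreserving measurePreserving_reflect

theorem inner_reflect_partialFourierTest_right (f : L2 n) (φ : TestFun n) :
    inner ℂ f (reflect (partialFourierTest φ)) =
      ∫ p, conj (f p) * partialFourier φ (-p.1, p.2) := by
  rw [L2.inner_def]
  refine integral_congr_ae ?_
  filter_upwards [reflect_partialFourierTest_coeFn φ] with p hp
  rw [hp, RCLike.inner_apply, mul_comm]

theorem inner_partialFourierCLM_left (f g : L2 n) :
    inner ℂ (partialFourierCLM n f) g = inner ℂ f (reflect (partialFourierCLM n g)) := by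
  refine TestFun.denseRange_toL2.induction_on f (isClosed_eq (by fun_prop)
    (by fun_prop)) fun χ => ?_
  refine TestFun.denseRange_toL2.induction_on g (isClosed_eq (by fun_prop)
    ((continuous_const.inner (reflect.continuous.comp (partialFourierCLM n).continuous))))
      fun φ => ?_
  rw [partialFourierCLM_toL2, partialFourierCLM_toL2, inner_toL2_right,
    inner_reflect_partialFourierTest_right]
  have e1 : ∫ p, conj (partialFourierTest χ p) * φ p = ∫ p, conj (partialFourier χ p) * φ p := by
    refine integral_congr_ae ?_
    filter_upwards [partialFourierTest_coeFn χ] with p hp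
    rw [hp]
  have e2 : ∫ p, conj (TestFun.toL2 χ p) * partialFourier φ (-p.1, p.2) =
      ∫ p, conj (χ p) * partialFourier φ (-p.1, p.2) := by
    refine integral_congr_ae ?_
    filter_upwards [TestFun.toL2_coeFn χ] with p hp
    rw [hp]
  rw [e1, e2]
  exact integral_conj_partialFourier_mul (ae_of_all _ fun y => (χ.slice y).integrable) φ
    (integrable_conj_mul (memLp_partialFourier χ) φ.memLp)
    (integrable_conj_mul χ.memLp (memLp_partialFourier_neg φ))

/-- An isometry whose adjoint preserves norms is onto. With `w` the adjoint applied to `v`, both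
`‖w‖ = ‖v‖` and `(V w, v) = ‖w‖²` hold, so `‖V w - v‖² = 0`. -/
theorem surjective_partialFourierCLM : Function.Surjective (partialFourierCLM n) := by
  intro v
  refine ⟨reflect (partialFourierCLM n v), ?_⟩
  set w := reflect (partialFourierCLM n v) with hw
  have hn : ‖w‖ = ‖v‖ := by rw [hw, LinearIsometry.norm_map, norm_partialFourierCLM]
  have hin : inner ℂ (partialFourierCLM n w) v = ((‖w‖ : ℂ)) ^ 2 := by
    rw [inner_partialFourierCLM_left, ← hw]
    exact inner_self_eq_norm_sq_to_K w
  have h : ‖partialFourierCLM n w - v‖ ^ 2 = 0 := by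
    rw [norm_sub_sq (𝕜 := ℂ), hin, norm_partialFourierCLM, hn, ← Complex.ofReal_pow]
    simp only [RCLike.re_to_complex, Complex.ofReal_re]
    ring
  exact sub_eq_zero.1 (norm_eq_zero.1 (pow_eq_zero_iff (two_ne_zero)|>.1 h))

/-- The partial Fourier transform as a unitary operator on `L²`. -/
def partialFourierL2 (n : ℕ) : L2 n ≃ₗᵢ[ℂ] L2 n :=
  LinearIsometryEquiv.ofSurjective ⟨(partialFourierCLM n).toLinearMap, norm_partialFourierCLM⟩
    surjective_partialFourierCLM

theorem partialFourierL2_apply (f : L2 n) : partialFourierL2 n f = partialFourierCLM n f := rfl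

theorem partialFourierL2_toL2_coeFn (φ : TestFun n) :
    partialFourierL2 n (TestFun.toL2 φ) =ᵐ[volume] partialFourier φ := by
  rw [partialFourierL2_apply, partialFourierCLM_toL2]
  exact partialFourierTest_coeFn φ

theorem locallyIntegrable_comp_snd {N : EuclideanSpace ℝ (Fin n) → ℝ}
    (hN : LocallyIntegrable N) : LocallyIntegrable (fun p : Space n => N p.2) := by
  rintro ⟨ξ, y⟩
  obtain ⟨W, hW, hNW⟩ := hN y
  refine ⟨Metric.ball ξ 1 ×ˢ W, prod_mem_nhds (Metric.ball_mem_nhds ξ one_pos) hW, ?_⟩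
  rw [IntegrableOn, Measure.volume_eq_prod, ← Measure.prod_restrict]
  have h1 : Integrable (fun _ : ℝ => (1 : ℝ)) (volume.restrict (Metric.ball ξ 1)) :=
    integrableOn_const (by simp)
  simpa using h1.mul_prod hNW

/-- Needed for functions that are not test functions: `ψ ∂φ/∂x₁` with nonsmooth `ψ`, and elements of
the weighted space. Both sides are locally integrable and, by the adjoint formula, have the same
integrals against test functions. -/
theorem partialFourierL2_coeFn {g : Space n → ℂ} (hgm : StronglyMeasurable g)
    (hg : MemLp g 2 volume) (hs : ∀ᵐ y, Integrable fun x : ℝ => g (x, y))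
    (hloc : LocallyIntegrable fun y => ∫ x : ℝ, ‖g (x, y)‖) :
    partialFourierL2 n (hg.toLp g) =ᵐ[volume] partialFourier g := by
  set f : L2 n := hg.toLp g with hf
  have hpl : LocallyIntegrable (partialFourier g) := by
    refine (locallyIntegrable_comp_snd hloc).mono
      (stronglyMeasurable_partialFourier hgm).aestronglyMeasurable (ae_of_all _ fun p => ?_)
    refine (norm_partialFourier_le g p).trans (le_abs_self _)
  have hVl : LocallyIntegrable (partialFourierL2 n f) :=
    (Lp.memLp (partialFourierL2 n f)).locallyIntegrable (by norm_num)
  have hconj : ∀ {h : Space n → ℂ}, LocallyIntegrable h → LocallyIntegrable fun p => conj (h p) :=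
    fun {h} hh => hh.mono (Complex.continuous_conj.comp_aestronglyMeasurable
      hh.aestronglyMeasurable) (ae_of_all _ fun p => by simp)
  have key := ae_eq_of_integral_contDiff_smul_eq (hconj hVl) (hconj hpl) (fun χ hχ hχ' => by
    set φ : TestFun n := TestFun.ofContDiff (f := fun p => (χ p : ℂ))
      (Complex.ofRealCLM.contDiff.comp hχ) (hχ'.comp_left (g := Complex.ofReal) rfl) with hφ
    have h1 : ∫ p, conj (partialFourierL2 n f p) * φ p = ∫ p, conj (partialFourier g p) * φ p := by
      rw [← inner_toL2_right, partialFourierL2_apply, inner_partialFourierCLM_left,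
        partialFourierCLM_toL2, inner_reflect_partialFourierTest_right]
      rw [integral_conj_partialFourier_mul hs]
      · refine integral_congr_ae ?_
        filter_upwards [hg.coeFn_toLp] with p hp
        rw [hf, hp]
      · have := (hconj hpl).integrable_smul_left_of_hasCompactSupport φ.continuous
          φ.hasCompactSupport
        simpa [mul_comm] using this
      · exact integrable_conj_mul hg (memLp_partialFourier_neg φ)
    have e : ∀ h : Space n → ℂ, ∫ p, χ p • conj (h p) = ∫ p, conj (h p) * φ p := by
      intro h
      refine integral_congr_ae (ae_of_all _ fun p => ?_)
      change χ p • conj (h p) = conj (h p) * (χ p : ℂ)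
      rw [Complex.real_smul, mul_comm]
    rw [e, e, h1])
  filter_upwards [key] with p hp
  exact (starRingEnd ℂ).injective hp

/-- The `L²` partial Fourier transform of a continuous compactly supported function. -/
theorem partialFourierL2_coeFn_of_hasCompactSupport {g : Space n → ℂ} (hgc : Continuous g)
    (hgs : HasCompactSupport g) :
    partialFourierL2 n ((hgc.memLp_of_hasCompactSupport hgs).toLp g) =ᵐ[volume]
      partialFourier g := by
  refine partialFourierL2_coeFn hgc.stronglyMeasurable _ (ae_of_all _ fun y => ?_) ?_
  · exact (hgc.comp (by fun_prop)).integrable_of_hasCompactSupport (hasCompactSupport_slice hgs y)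
  · refine Integrable.locallyIntegrable ?_
    have := (hgc.integrable_of_hasCompactSupport (μ := volume) hgs).norm
    rw [Measure.volume_eq_prod] at this
    exact this.integral_prod_right

end PartialFourier

/-! ### A criterion for essential self-adjointness -/

section Adjoint

variable {H : Type*} [NormedAddCommGroup H] [InnerProductSpace ℂ H] [CompleteSpace H]

/-- A vector that annihilates the adjoint of a subspace of `H × H` lies in its closure. -/
theorem mem_topologicalClosure_of_forall_adjoint (S : Submodule ℂ (H × H)) {x : H × H}
    (h : ∀ v w, (v, w) ∈ S.adjoint → inner ℂ w x.1 = inner ℂ v x.2) :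
    x ∈ S.topologicalClosure := by
  -- Orthogonal complements need the Hilbert product norm, whereas `H × H` carries the sup norm; the
  -- topologies agree.
  set e := (WithLp.linearEquiv 2 ℂ (H × H)).symm with he
  have hmem : e x ∈ (S.map e.toLinearMap)ᗮᗮ := by
    rw [Submodule.mem_orthogonal]
    intro y hy
    have hy' : ∀ a b, (a, b) ∈ S → inner ℂ a y.fst + inner ℂ b y.snd = 0 := by
      intro a b hab
      have := (Submodule.mem_orthogonal _ _).1 hy (e (a, b)) ⟨(a, b), hab, rfl⟩
      rwa [WithLp.prod_inner_apply] at this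
    -- The adjoint of `S` is its orthogonal complement rotated by a quarter turn.
    have hadj : (y.snd, -y.fst) ∈ S.adjoint := by
      rw [Submodule.mem_adjoint_iff]
      intro a b hab
      rw [inner_neg_right, sub_neg_eq_add, add_comm]
      exact hy' a b hab
    have h1 := h _ _ hadj
    rw [inner_neg_left] at h1
    rw [WithLp.prod_inner_apply]
    change inner ℂ y.fst x.1 + inner ℂ y.snd x.2 = 0
    rw [← h1, add_neg_cancel]
  rw [Submodule.orthogonal_orthogonal_eq_closure, ← SetLike.mem_coe,
    Submodule.topologicalClosure_coe] at hmem
  rw [← SetLike.mem_coe, Submodule.topologicalClosure_coe]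
  have hc : Continuous (WithLp.ofLp : WithLp 2 (H × H) → H × H) :=
    WithLp.prod_continuous_ofLp 2 H H
  have := map_mem_closure hc hmem (t := (S : Set (H × H))) (by
    rintro _ ⟨z, hz, rfl⟩
    exact hz)
  exact this

/-- A densely defined operator whose adjoint is symmetric and extends it is essentially
self-adjoint. -/
theorem closure_eq_adjoint_of_symmetric {A : H →ₗ.[ℂ] H} (hA : Dense (A.domain : Set H))
    (hle : A ≤ A.adjoint) (hsym : A.adjoint.IsFormalAdjoint A.adjoint) :
    A.closure = A.adjoint ∧ IsSelfAdjoint A.adjoint := by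
  have hcl : A.adjoint.IsClosed := LinearPMap.adjoint_isClosed hA
  have hd : Dense (A.adjoint.domain : Set H) := hA.mono hle.1
  constructor
  · apply LinearPMap.eq_of_eq_graph
    rw [← (hcl.isClosable.leIsClosable hle).graph_closure_eq_closure_graph]
    refine le_antisymm (Submodule.topologicalClosure_minimal _ (LinearPMap.le_graph_of_le hle) hcl)
      fun x hx => mem_topologicalClosure_of_forall_adjoint _ fun v w hvw => ?_
    rw [← LinearPMap.adjoint_graph_eq_graph_adjoint hA] at hvw
    obtain ⟨hv, rfl⟩ := LinearPMap.apply_eq_of_mem_graph hvw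
    obtain ⟨hx1, hx2⟩ := LinearPMap.apply_eq_of_mem_graph (u := x.1) (w := x.2) hx
    rw [← hx2]
    exact hsym ⟨v, hv⟩ ⟨x.1, hx1⟩
  · rw [LinearPMap.isSelfAdjoint_def]
    -- Taking adjoints in `A ≤ A*` gives `A** ≤ A*`; the opposite inclusion is the symmetry of `A*`.
    refine le_antisymm ?_ (LinearPMap.IsFormalAdjoint.le_adjoint hd hsym)
    apply LinearPMap.le_of_le_graph
    intro x hx
    rw [LinearPMap.adjoint_graph_eq_graph_adjoint hd, Submodule.mem_adjoint_iff] at hx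
    rw [LinearPMap.adjoint_graph_eq_graph_adjoint hA, Submodule.mem_adjoint_iff]
    exact fun a b hab => hx a b (LinearPMap.le_graph_of_le hle hab)

end Adjoint

section

variable {H : Type*} [NormedAddCommGroup H] [InnerProductSpace ℂ H]
variable {α : Type*} [MeasurableSpace α] {ν : Measure α}

theorem IsDiagonal.isFormalAdjoint {T : H →ₗ.[ℂ] H} {F : H ≃ₗᵢ[ℂ] Lp ℂ 2 ν} {a : α → ℝ}
    (hT : IsDiagonal T F a) : T.IsFormalAdjoint T := by
  intro x y
  rw [← F.inner_map_map, ← F.inner_map_map (x : H), L2.inner_def, L2.inner_def]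
  refine integral_congr_ae ?_
  filter_upwards [(hT _ _).1 (T.mem_graph x), (hT _ _).1 (T.mem_graph y)] with p h1 h2
  rw [← h1, ← h2]
  simp only [RCLike.inner_apply, map_mul, Complex.conj_ofReal]
  ring

end

/-! ### Diagonalising the shear flow operator -/

section Core

variable {n : ℕ}

theorem partialFourier_snd_mul (c : EuclideanSpace ℝ (Fin n) → ℂ) (f : Space n → ℂ)
    (p : Space n) :
    partialFourier (fun q => c q.2 * f q) p = c p.2 * partialFourier f p := by
  rw [partialFourier_eq_integral, partialFourier_eq_integral, ← integral_const_mul]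
  refine integral_congr_ae (ae_of_all _ fun x => ?_)
  simp only [Circle.smul_def, smul_eq_mul]
  ring

theorem TestFun.hasDerivAt_slice (φ : TestFun n) (y : EuclideanSpace ℝ (Fin n)) (x : ℝ) :
    HasDerivAt (φ.slice y) (fderiv ℝ φ (x, y) (1, 0)) x := by
  have h1 : HasFDerivAt φ (fderiv ℝ φ (x, y)) (x, y) :=
    ((φ.contDiff.differentiable (by simp)) (x, y)).hasFDerivAt
  have h2 : HasDerivAt (fun t : ℝ => (t, y)) ((1 : ℝ), (0 : EuclideanSpace ℝ (Fin n))) x :=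
    (hasDerivAt_id x).prodMk (hasDerivAt_const x y)
  exact h1.comp_hasDerivAt x h2

theorem partialFourier_fderiv (φ : TestFun n) (p : Space n) :
    partialFourier (fun q => fderiv ℝ φ q (1, 0)) p =
      2 * Real.pi * Complex.I * p.1 * partialFourier φ p := by
  have hd : deriv (φ.slice p.2) = fun x => fderiv ℝ φ (x, p.2) (1, 0) :=
    funext fun x => (φ.hasDerivAt_slice p.2 x).deriv
  have hi : Integrable (deriv (φ.slice p.2)) := (SchwartzMap.derivCLM ℝ ℂ (φ.slice p.2)).integrable
  have := Real.fourier_deriv (φ.slice p.2).integrable (φ.slice p.2).differentiable hi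
  rw [hd] at this
  exact congrFun this p.1

variable {ψ : EuclideanSpace ℝ (Fin n) → ℝ}

/-- The symbol of the shear flow operator. -/
def symbol (ψ : EuclideanSpace ℝ (Fin n) → ℝ) (p : Space n) : ℝ :=
  2 * Real.pi * p.1 * ψ p.2

theorem partialFourier_shearFun (φ : TestFun n) (p : Space n) :
    partialFourier (shearFun ψ φ) p = symbol ψ p * partialFourier φ p := by
  have := partialFourier_snd_mul (fun y => -Complex.I * (ψ y : ℂ))
    (fun q => fderiv ℝ φ q (1, 0)) p
  rw [partialFourier_fderiv] at this
  refine this.trans ?_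
  rw [symbol]
  push_cast
  linear_combination (-(2 * Real.pi * p.1 * ψ p.2 * partialFourier φ p) : ℂ) * Complex.I_sq

theorem partialFourierL2_shearMap_coeFn (hψ : Continuous ψ) (φ : TestFun n) :
    partialFourierL2 n (shearMap ψ hψ φ) =ᵐ[volume]
      fun p => (symbol ψ p : ℂ) * partialFourier φ p := by
  have hd : Continuous fun x => fderiv ℝ φ x (1, 0) :=
    (φ.contDiff.continuous_fderiv (by simp)).clm_apply continuous_const
  have h1 : Continuous (shearFun ψ φ) := by
    unfold shearFun
    fun_prop
  have h2 : HasCompactSupport (shearFun ψ φ) :=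
    (φ.hasCompactSupport.fderiv_apply ℝ (1, 0)).mul_left
  filter_upwards [partialFourierL2_coeFn_of_hasCompactSupport h1 h2] with p hp
  rw [← partialFourier_shearFun]
  exact hp

/-- The average is a convolution in `x₁` with the indicator of `(0, 1]`, with `x'` as a parameter,
so it inherits the smoothness of `η`. -/
theorem contDiff_integral_translate (η : TestFun n) :
    ContDiff ℝ ∞ fun p : Space n => ∫ r in (0 : ℝ)..1, η (p.1 - r, p.2) := by
  have h := contDiffOn_convolution_right_with_param (n := ⊤) (𝕜 := ℝ) (μ := (volume : Measure ℝ))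
    (f := (Set.Ioc (0 : ℝ) 1).indicator fun _ => (1 : ℝ)) (ContinuousLinearMap.lsmul ℝ ℝ)
    (g := fun (y : EuclideanSpace ℝ (Fin n)) (x : ℝ) => η (x, y)) (s := Set.univ)
    (k := Prod.fst '' tsupport η) isOpen_univ (η.hasCompactSupport.isCompact.image continuous_fst)
    (by
      intro y x _ hx
      by_contra h
      exact hx ⟨(x, y), subset_tsupport _ h, rfl⟩)
    ((integrable_indicator_iff measurableSet_Ioc).2
      (integrableOn_const (by simp))).locallyIntegrable
    (η.contDiff.comp (contDiff_snd.prodMk contDiff_fst)).contDiffOn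
  rw [Set.univ_prod_univ, contDiffOn_univ] at h
  have h2 := h.comp (contDiff_snd.prodMk contDiff_fst : ContDiff ℝ ∞ fun p : Space n => (p.2, p.1))
  convert h2 using 1
  funext p
  simp only [Function.comp_apply, convolution_def, ContinuousLinearMap.lsmul_apply]
  rw [intervalIntegral.integral_of_le zero_le_one, ← integral_indicator measurableSet_Ioc]
  refine integral_congr_ae (ae_of_all _ fun r => ?_)
  by_cases hr : r ∈ Set.Ioc (0 : ℝ) 1 <;> simp [hr]

theorem hasCompactSupport_integral_translate (η : TestFun n) :
    HasCompactSupport fun p : Space n => ∫ r in (0 : ℝ)..1, η (p.1 - r, p.2) := by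
  refine HasCompactSupport.intro ((η.hasCompactSupport.isCompact.prod
    (isCompact_Icc (a := (0 : ℝ)) (b := 1))).image
    (f := fun q : Space n × ℝ => (q.1.1 + q.2, q.1.2)) (by fun_prop)) fun p hp => ?_
  refine intervalIntegral.integral_zero_ae (ae_of_all _ fun r hr => ?_)
  rw [Set.uIoc_of_le zero_le_one] at hr
  by_contra h
  exact hp ⟨((p.1 - r, p.2), r), ⟨subset_tsupport _ h, Set.Ioc_subset_Icc_self hr⟩, by simp⟩

/-- The average of a test function over translates in the first variable. -/
def TestFun.average (η : TestFun n) : TestFun n :=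
  TestFun.ofContDiff (contDiff_integral_translate η) (hasCompactSupport_integral_translate η)

/-- On each slice the average is a difference of two values of a primitive of `η`. The derivative is
thus a finite difference, whose Fourier multiplier `1 - e^{-2πiξ}` is bounded, unlike `2πiξ`. -/
theorem TestFun.fderiv_average (η : TestFun n) (p : Space n) :
    fderiv ℝ η.average p (1, 0) = η p - η (p.1 - 1, p.2) := by
  have h1 := η.average.hasDerivAt_slice p.2 p.1
  have hc : Continuous fun t : ℝ => η (t, p.2) := η.continuous.comp (by fun_prop)
  have hi : ∀ a b, IntervalIntegrable (fun t : ℝ => η (t, p.2)) volume a b :=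
    fun a b => hc.intervalIntegrable a b
  have e : (η.average.slice p.2 : ℝ → ℂ) =
      fun x => (∫ t in (0 : ℝ)..x, η (t, p.2)) - ∫ t in (0 : ℝ)..(x - 1), η (t, p.2) := by
    funext x
    rw [intervalIntegral.integral_interval_sub_left (hi _ _) (hi _ _)]
    change (∫ r in (0 : ℝ)..1, η (x - r, p.2)) = _
    rw [intervalIntegral.integral_comp_sub_left (fun t => η (t, p.2)), sub_zero]
  have hF : ∀ x, HasDerivAt (fun u => ∫ t in (0 : ℝ)..u, η (t, p.2)) (η (x, p.2)) x :=
    fun x => (hc.integral_hasStrictDerivAt 0 x).hasDerivAt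
  have h2 : HasDerivAt (η.average.slice p.2) (η (p.1, p.2) - η (p.1 - 1, p.2)) p.1 := by
    rw [e]
    exact (hF p.1).sub ((hF (p.1 - 1)).comp_sub_const p.1 1)
  exact h1.unique h2

theorem partialFourier_translate (f : Space n → ℂ) (p : Space n) :
    partialFourier (fun q => f (q.1 - 1, q.2)) p = 𝐞 (-p.1) * partialFourier f p := by
  rw [partialFourier_eq_integral, partialFourier_eq_integral, ← integral_const_mul,
    ← integral_add_right_eq_self _ (1 : ℝ)]
  refine integral_congr_ae (ae_of_all _ fun x => ?_)
  simp only [add_sub_cancel_right, Circle.smul_def, smul_eq_mul]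
  rw [← mul_assoc, ← Circle.coe_mul, ← AddChar.map_add_eq_mul]
  congr 3
  ring_nf

theorem partialFourier_average (η : TestFun n) (p : Space n) :
    2 * Real.pi * Complex.I * p.1 * partialFourier η.average p =
      (1 - 𝐞 (-p.1)) * partialFourier η p := by
  rw [← partialFourier_fderiv, funext η.fderiv_average, sub_mul, one_mul,
    ← partialFourier_translate]
  rw [partialFourier_eq_integral, partialFourier_eq_integral, partialFourier_eq_integral,
    ← integral_sub]
  · refine integral_congr_ae (ae_of_all _ fun x => ?_)
    simp only [smul_sub]
  · have := (Real.fourierIntegral_convergent_iff (μ := volume) p.1).2 (η.slice p.2).integrable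
    simpa [mul_comm, TestFun.slice_apply] using this
  · have := (Real.fourierIntegral_convergent_iff (μ := volume) p.1).2
      ((η.slice p.2).integrable.comp_sub_right 1)
    simpa [mul_comm, TestFun.slice_apply] using this

theorem ae_fourierChar_ne_one :
    ∀ᵐ p : Space n, (p.1 ≠ 0 ∧ (1 - 𝐞 (-p.1) : ℂ) ≠ 0) := by
  have h : ∀ᵐ ξ : ℝ, ξ ∉ Set.range ((↑) : ℤ → ℝ) :=
    (Set.countable_range _).ae_notMem _
  have h2 : ∀ᵐ ξ : ℝ, (ξ ≠ 0 ∧ (1 - 𝐞 (-ξ) : ℂ) ≠ 0) := by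
    filter_upwards [h] with ξ hξ
    refine ⟨fun h0 => hξ ⟨0, by simp [h0]⟩, fun h0 => hξ ?_⟩
    rw [sub_eq_zero, Real.fourierChar_apply, eq_comm, Complex.exp_eq_one_iff] at h0
    obtain ⟨m, hm⟩ := h0
    refine ⟨-m, ?_⟩
    have h3 : (2 * Real.pi * Complex.I : ℂ) ≠ 0 := Complex.two_pi_I_ne_zero
    have h4 : ((-ξ : ℝ) : ℂ) = m := by
      apply mul_left_cancel₀ h3
      rw [mul_comm _ (m : ℂ), ← hm]
      push_cast
      ring
    have h5 : -ξ = m := by exact_mod_cast h4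
    push_cast
    linarith
  exact Measure.quasiMeasurePreserving_fst.ae h2

theorem norm_one_sub_fourierChar_le (ξ : ℝ) : ‖(1 - 𝐞 (-ξ) : ℂ)‖ ≤ 2 * Real.pi * |ξ| := by
  have h := Real.norm_exp_I_mul_ofReal_sub_one_le (x := 2 * Real.pi * -ξ)
  rw [norm_sub_rev, Real.fourierChar_apply, mul_comm _ Complex.I]
  refine h.trans (le_of_eq ?_)
  rw [Real.norm_eq_abs, abs_mul, abs_neg, abs_of_pos Real.two_pi_pos]

/-- Products of `ψ` with test functions are total in `L²`. -/
theorem eq_zero_of_forall_integral_mul_testFun (hψ : Continuous ψ) (hψ0 : ∀ y, ψ y ≠ 0)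
    (f : L2 n) (h : ∀ η : TestFun n, ∫ p, conj (f p) * (ψ p.2 * η p) = 0) : f = 0 := by
  have hfl : LocallyIntegrable fun p => ψ p.2 • conj (f p) := by
    have h1 : LocallyIntegrable f := (Lp.memLp f).locallyIntegrable (by norm_num)
    have h2 : LocallyIntegrable fun p => conj (f p) :=
      h1.mono (Complex.continuous_conj.comp_aestronglyMeasurable
        h1.aestronglyMeasurable) (ae_of_all _ fun p => by simp)
    rw [← locallyIntegrableOn_univ] at h2 ⊢
    exact h2.continuousOn_smul isOpen_univ.isLocallyClosed (by fun_prop)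
  have h0 := ae_eq_zero_of_integral_contDiff_smul_eq_zero hfl (fun χ hχ hχ' => by
    have := h (TestFun.ofContDiff (f := fun p => (χ p : ℂ))
      (Complex.ofRealCLM.contDiff.comp hχ) (hχ'.comp_left (g := Complex.ofReal) rfl))
    rw [← this]
    refine integral_congr_ae (ae_of_all _ fun p => ?_)
    change χ p • (ψ p.2 • conj (f p)) = conj (f p) * ((ψ p.2 : ℂ) * (χ p : ℂ))
    rw [Complex.real_smul, Complex.real_smul]
    ring)
  apply Lp.ext
  filter_upwards [h0, Lp.coeFn_zero ℂ 2 (volume : Measure (Space n))] with p hp h1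
  rw [h1]
  rcases smul_eq_zero.1 hp with h2 | h2
  · exact absurd h2 (hψ0 _)
  · simpa using h2

/-- Density cannot be applied directly, since `a V v` is not known to be in `L²`. Testing only with
averages of test functions `η` replaces the unbounded multiplier by bounded ones: `φ̂ = m η̂` and `a
φ̂ = -iψ e η̂`. -/
theorem symbol_eq_of_forall_inner {ℓ : ℝ} {L : ℝ≥0} (hψ : IsRegularShear ψ ℓ L) {v w : L2 n}
    (h : ∀ φ : TestFun n, inner ℂ w (TestFun.toL2 φ) = inner ℂ v (shearMap ψ hψ.continuous φ)) :
    ∀ᵐ p, (symbol ψ p : ℂ) * partialFourierL2 n v p = partialFourierL2 n w p := by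
  set V := partialFourierL2 n with hV
  have hpos : ∀ y, 0 < ψ y := fun y => hψ.ell_pos.trans (hψ.ell_lt y)
  set e : Space n → ℂ := fun p => 1 - 𝐞 (-p.1) with he
  have hec : Continuous e := by
    rw [he]
    fun_prop
  set m : Space n → ℂ := fun p => e p / (2 * Real.pi * Complex.I * p.1) with hm
  have hmm : Measurable m := by
    rw [hm]
    exact hec.measurable.div (by fun_prop)
  have hmb : ∀ p, ‖m p‖ ≤ 1 := by
    intro p
    rw [hm]
    simp only [norm_div, norm_mul, Complex.norm_I, Complex.norm_real, mul_one,
      RCLike.norm_ofNat, Real.norm_eq_abs, abs_of_pos Real.pi_pos]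
    exact div_le_one_of_le₀ (norm_one_sub_fourierChar_le p.1) (by positivity)
  have heb : ∀ p, ‖e p‖ ≤ 2 := by
    intro p
    refine (norm_sub_le _ _).trans ?_
    rw [norm_one, Circle.norm_coe]
    norm_num
  -- Chosen so that the hypothesis for `φ = η.average` says that `k` is orthogonal to `V(ψη)`. Here
  -- `k` is in `L²` because `|m| ≤ 1`, `|e| ≤ 2` and `1/ψ ≤ 1/ℓ`; totality of the `ψη` forces `k =
  -- 0`.
  set k : Space n → ℂ := fun p =>
    conj (m p) * ((ψ p.2 : ℂ)⁻¹ * V w p) - conj (-Complex.I * e p) * V v p with hk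
  have hψm : Measurable fun p : Space n => (ψ p.2 : ℂ)⁻¹ :=
    (Complex.measurable_ofReal.comp (hψ.continuous.measurable.comp measurable_snd)).inv
  have hkL : MemLp k 2 (volume : Measure (Space n)) := by
    refine MemLp.sub ?_ ?_
    · refine (Lp.memLp (V w)).of_le_mul (c := ℓ⁻¹) ?_ (ae_of_all _ fun p => ?_)
      · exact (Complex.continuous_conj.measurable.comp hmm).aestronglyMeasurable.mul
          (hψm.aestronglyMeasurable.mul (Lp.aestronglyMeasurable _))
      · rw [norm_mul, norm_mul, RCLike.norm_conj, norm_inv, Complex.norm_real,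
          Real.norm_of_nonneg (hpos _).le]
        calc ‖m p‖ * ((ψ p.2)⁻¹ * ‖V w p‖) ≤ 1 * (ℓ⁻¹ * ‖V w p‖) := by
              gcongr
              · exact mul_nonneg (inv_nonneg.2 (hpos _).le) (norm_nonneg _)
              · exact hmb p
              · exact hψ.ell_pos
              · exact (hψ.ell_lt _).le
          _ = _ := one_mul _
    · refine (Lp.memLp (V v)).of_le_mul (c := 2) ?_ (ae_of_all _ fun p => ?_)
      · refine AEStronglyMeasurable.mul ?_ (Lp.aestronglyMeasurable _)
        exact Continuous.aestronglyMeasurable (by fun_prop)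
      · rw [norm_mul, RCLike.norm_conj, norm_mul, norm_neg, Complex.norm_I, one_mul]
        gcongr
        exact heb p
  have hzero : V.symm (hkL.toLp k) = 0 := by
    refine eq_zero_of_forall_integral_mul_testFun hψ.continuous (fun y => (hpos y).ne') _
      fun η => ?_
    have hgc : Continuous fun p : Space n => (ψ p.2 : ℂ) * η p :=
      (Complex.continuous_ofReal.comp (hψ.continuous.comp continuous_snd)).mul η.continuous
    have hgs : HasCompactSupport fun p : Space n => (ψ p.2 : ℂ) * η p :=
      η.hasCompactSupport.mul_left
    set g : L2 n := (hgc.memLp_of_hasCompactSupport hgs).toLp _ with hg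
    have hgV : V g =ᵐ[volume] fun p => (ψ p.2 : ℂ) * partialFourier η p := by
      filter_upwards [partialFourierL2_coeFn_of_hasCompactSupport hgc hgs] with p hp
      rw [hp]
      exact partialFourier_snd_mul (fun y => (ψ y : ℂ)) η p
    have h1 : ∫ p, conj (V.symm (hkL.toLp k) p) * ((ψ p.2 : ℂ) * η p) =
        inner ℂ (V.symm (hkL.toLp k)) g := by
      rw [L2.inner_def]
      refine integral_congr_ae ?_
      filter_upwards [(hgc.memLp_of_hasCompactSupport hgs).coeFn_toLp] with p hp
      rw [hg, hp, RCLike.inner_apply, mul_comm]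
    have hφ := h η.average
    rw [← V.inner_map_map, ← V.inner_map_map v, L2.inner_def, L2.inner_def] at hφ
    rw [h1, ← V.inner_map_map, V.apply_symm_apply, L2.inner_def]
    have hI1 := L2.integrable_inner (𝕜 := ℂ) (V w) (V (TestFun.toL2 η.average))
    have hI2 := L2.integrable_inner (𝕜 := ℂ) (V v) (V (shearMap ψ hψ.continuous η.average))
    rw [← sub_eq_zero, ← integral_sub hI1 hI2] at hφ
    rw [← hφ]
    refine integral_congr_ae ?_
    filter_upwards [hkL.coeFn_toLp, hgV, partialFourierL2_toL2_coeFn η.average,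
      partialFourierL2_shearMap_coeFn hψ.continuous η.average, ae_fourierChar_ne_one]
      with p h2 h3 h4 h5 h6
    rw [h2, h3, h4, h5]
    simp only [RCLike.inner_apply, hk, map_sub, map_mul, Complex.conj_conj, map_inv₀,
      Complex.conj_ofReal]
    have hav := partialFourier_average η p
    have hp1 : (p.1 : ℂ) ≠ 0 := by exact_mod_cast h6.1
    have hψp : (ψ p.2 : ℂ) ≠ 0 := by exact_mod_cast (hpos p.2).ne'
    have hpi : (Real.pi : ℂ) ≠ 0 := by exact_mod_cast Real.pi_ne_zero
    have hav2 : partialFourier η.average p = m p * partialFourier η p := by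
      rw [hm]
      simp only
      rw [div_mul_eq_mul_div, eq_div_iff (mul_ne_zero Complex.two_pi_I_ne_zero hp1), ← hav]
      ring
    have hav3 : (symbol ψ p : ℂ) * partialFourier η.average p =
        -Complex.I * ψ p.2 * (e p * partialFourier η p) := by
      rw [← hav, symbol]
      push_cast
      linear_combination (2 * Real.pi * p.1 * ψ p.2 * partialFourier η.average p : ℂ)
        * Complex.I_sq
    rw [hav3, hav2]
    field_simp
  have hk0 : hkL.toLp k = 0 := by
    rw [← V.apply_symm_apply (hkL.toLp k), hzero, map_zero]
  have hkae : k =ᵐ[volume] 0 := by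
    have := hkL.coeFn_toLp
    rw [hk0] at this
    exact this.symm.trans (Lp.coeFn_zero ℂ 2 volume)
  -- Since `m = e/(2πiξ)`, the equation `k = 0` is the claim multiplied by a factor containing `conj
  -- e`, which vanishes only for integer `ξ`, a null set.
  filter_upwards [hkae, ae_fourierChar_ne_one] with p hp h6
  have hp1 : (p.1 : ℂ) ≠ 0 := by exact_mod_cast h6.1
  have hψp : (ψ p.2 : ℂ) ≠ 0 := by exact_mod_cast (hpos p.2).ne'
  have hpi : (Real.pi : ℂ) ≠ 0 := by exact_mod_cast Real.pi_ne_zero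
  have hep : conj (e p) ≠ 0 := by simpa using h6.2
  simp only [hk, hm, Pi.zero_apply, map_mul, map_div₀, map_neg, Complex.conj_I,
    Complex.conj_ofReal, map_ofNat] at hp
  rw [sub_eq_zero] at hp
  field_simp at hp
  rw [symbol]
  push_cast
  have : conj (e p) * (2 * Real.pi * p.1 * ψ p.2 * V v p) = conj (e p) * V w p := by
    rw [Complex.I_sq] at hp
    linear_combination conj (e p) * hp
  exact mul_left_cancel₀ hep this

theorem shearFlowCore_dense (hψ : Continuous ψ) :
    Dense ((shearFlowCore ψ hψ).domain : Set (L2 n)) :=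
  TestFun.denseRange_toL2

theorem mem_graph_shearFlowCore {hψ : Continuous ψ} {u w : L2 n} :
    (u, w) ∈ (shearFlowCore ψ hψ).graph ↔ ∃ φ, TestFun.toL2 φ = u ∧ shearMap ψ hψ φ = w := by
  constructor
  · intro h
    obtain ⟨⟨φ, hφ⟩, hw⟩ := LinearPMap.apply_eq_of_mem_graph h
    subst hφ
    exact ⟨φ, rfl, by rw [← hw, shearFlowCore_apply]⟩
  · rintro ⟨φ, rfl, rfl⟩
    rw [← shearFlowCore_apply]
    exact LinearPMap.mem_graph (shearFlowCore ψ hψ) ⟨TestFun.toL2 φ, ⟨φ, rfl⟩⟩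

theorem isDiagonal_adjoint_shearFlowCore {ℓ : ℝ} {L : ℝ≥0} (hψ : IsRegularShear ψ ℓ L) :
    IsDiagonal (shearFlowCore ψ hψ.continuous).adjoint (partialFourierL2 n) (symbol ψ) := by
  intro v w
  rw [LinearPMap.adjoint_graph_eq_graph_adjoint (shearFlowCore_dense _),
    Submodule.mem_adjoint_iff]
  constructor
  · intro h
    refine symbol_eq_of_forall_inner hψ fun φ => ?_
    have := h _ _ (mem_graph_shearFlowCore.2 ⟨φ, rfl, rfl⟩)
    rw [sub_eq_zero] at this
    rw [← inner_conj_symm, ← this, inner_conj_symm]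
  · intro h a b hab
    obtain ⟨φ, rfl, rfl⟩ := mem_graph_shearFlowCore.1 hab
    rw [sub_eq_zero, ← (partialFourierL2 n).inner_map_map,
      ← (partialFourierL2 n).inner_map_map (TestFun.toL2 φ), L2.inner_def, L2.inner_def]
    refine integral_congr_ae ?_
    filter_upwards [h, partialFourierL2_toL2_coeFn φ,
      partialFourierL2_shearMap_coeFn hψ.continuous φ] with p h1 h2 h3
    rw [h2, h3, ← h1]
    simp only [RCLike.inner_apply, map_mul, Complex.conj_ofReal]
    ring

theorem shearFlow_eq_adjoint {ℓ : ℝ} {L : ℝ≥0} (hψ : IsRegularShear ψ ℓ L) :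
    shearFlow ψ hψ.continuous = (shearFlowCore ψ hψ.continuous).adjoint ∧
      IsSelfAdjoint (shearFlowCore ψ hψ.continuous).adjoint := by
  have hD := isDiagonal_adjoint_shearFlowCore hψ
  refine closure_eq_adjoint_of_symmetric (shearFlowCore_dense _) ?_ hD.isFormalAdjoint
  apply LinearPMap.le_of_le_graph
  rintro ⟨u, w⟩ huw
  obtain ⟨φ, rfl, rfl⟩ := mem_graph_shearFlowCore.1 huw
  rw [hD]
  filter_upwards [partialFourierL2_toL2_coeFn φ,
    partialFourierL2_shearMap_coeFn hψ.continuous φ] with p h2 h3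
  rw [h2, h3]

end Core

/-! ### Weighted estimates on the line -/

section Weighted

/-- The constant in the embedding of the weighted space into `L¹(ℝ)`, squared. -/
def weightConst (σ : ℝ) : ℝ := ∫ x : ℝ, (1 + x ^ 2) ^ (-σ)

theorem integrable_weight {σ : ℝ} (hσ : 1 / 2 < σ) :
    Integrable fun x : ℝ => (1 + x ^ 2) ^ (-σ) := by
  have := integrable_rpow_neg_one_add_norm_sq (E := ℝ) (μ := volume) (r := 2 * σ)
    (by simp only [Module.finrank_self, Nat.cast_one]; linarith)
  refine this.congr (ae_of_all _ fun x => ?_)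
  simp only [Real.norm_eq_abs, sq_abs]
  congr 1
  ring

theorem weightConst_nonneg (σ : ℝ) : 0 ≤ weightConst σ :=
  integral_nonneg fun x => by positivity

/-- Cauchy–Schwarz inequality for real functions. -/
theorem integral_mul_le_sqrt_mul_sqrt {α : Type*} [MeasurableSpace α] {ν : Measure α}
    {f g : α → ℝ} (hf0 : ∀ x, 0 ≤ f x) (hg0 : ∀ x, 0 ≤ g x) (hf : MemLp f 2 ν)
    (hg : MemLp g 2 ν) :
    ∫ x, f x * g x ∂ν ≤ √(∫ x, f x ^ 2 ∂ν) * √(∫ x, g x ^ 2 ∂ν) := by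
  have := integral_mul_le_Lp_mul_Lq_of_nonneg (μ := ν) (p := 2) (q := 2)
    Real.HolderConjugate.two_two
    (ae_of_all _ hf0) (ae_of_all _ hg0) (by simpa using hf) (by simpa using hg)
  simpa [Real.sqrt_eq_rpow] using this

/-- Cauchy–Schwarz for `|h| = (1+x²)^{-σ/2} · (1+x²)^{σ/2}|h|`; the first factor is square
integrable because `σ > 1/2`. -/
theorem integrable_and_integral_norm_le_of_weight {σ : ℝ} (hσ : 1 / 2 < σ) {h : ℝ → ℂ}
    (hm : AEStronglyMeasurable h) (hi : Integrable fun x : ℝ => (1 + x ^ 2) ^ σ * ‖h x‖ ^ 2) :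
    Integrable h ∧
      ∫ x, ‖h x‖ ≤ √(weightConst σ) * √(∫ x : ℝ, (1 + x ^ 2) ^ σ * ‖h x‖ ^ 2) := by
  have hpos : ∀ x : ℝ, 0 < 1 + x ^ 2 := fun x => by positivity
  set a : ℝ → ℝ := fun x => (1 + x ^ 2) ^ (-σ / 2) with ha
  set b : ℝ → ℝ := fun x => (1 + x ^ 2) ^ (σ / 2) * ‖h x‖ with hb
  have hc : ∀ s : ℝ, Continuous fun x : ℝ => (1 + x ^ 2) ^ s := fun s =>
    Continuous.rpow_const (by fun_prop) fun x => Or.inl (hpos x).ne'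
  have ha2 : ∀ x, a x ^ 2 = (1 + x ^ 2) ^ (-σ) := by
    intro x
    rw [ha, ← Real.rpow_natCast, ← Real.rpow_mul (hpos x).le]
    congr 1
    push_cast
    ring
  have hb2 : ∀ x, b x ^ 2 = (1 + x ^ 2) ^ σ * ‖h x‖ ^ 2 := by
    intro x
    rw [hb]
    simp only
    rw [mul_pow, ← Real.rpow_natCast ((1 + x ^ 2) ^ (σ / 2)), ← Real.rpow_mul (hpos x).le]
    congr 2
    push_cast
    ring
  have hab : ∀ x, a x * b x = ‖h x‖ := by
    intro x
    rw [ha, hb]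
    simp only
    rw [← mul_assoc, ← Real.rpow_add (hpos x), neg_div, neg_add_cancel, Real.rpow_zero, one_mul]
  have haL : MemLp a 2 := by
    rw [memLp_two_iff_integrable_sq (hc _).aestronglyMeasurable]
    exact (integrable_weight hσ).congr (ae_of_all _ fun x => (ha2 x).symm)
  have hbL : MemLp b 2 := by
    have hbm : AEStronglyMeasurable b := (hc _).aestronglyMeasurable.mul hm.norm
    rw [memLp_two_iff_integrable_sq hbm]
    exact hi.congr (ae_of_all _ fun x => (hb2 x).symm)
  constructor
  · have : Integrable (a * b) := haL.integrable_mul hbL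
    refine (integrable_norm_iff hm).1 (this.congr (ae_of_all _ hab))
  · have := integral_mul_le_sqrt_mul_sqrt (fun x => by positivity) (fun x => by positivity) haL hbL
    simpa only [hab, ha2, hb2, weightConst] using this

theorem hasDerivAt_integral_Iic {q : ℝ → ℂ} (hq : Continuous q) (hi : Integrable q) (t : ℝ) :
    HasDerivAt (fun s => ∫ ξ in Set.Iic s, q ξ) (q t) t := by
  have e : (fun s => ∫ ξ in Set.Iic s, q ξ) =
      fun s => (∫ ξ in Set.Iic 0, q ξ) + ∫ ξ in (0 : ℝ)..s, q ξ := by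
    funext s
    rw [← intervalIntegral.integral_Iic_sub_Iic hi.integrableOn hi.integrableOn]
    ring
  rw [e]
  exact ((hq.integral_hasStrictDerivAt 0 t).hasDerivAt).const_add _

end Weighted

/-! ### Differentiating the spectral family -/

section Derivative

variable {n : ℕ} {σ : ℝ}

/-- The weighted norm of the slices of `f`, squared. -/
def sliceWeight (σ : ℝ) (f : L2 n) (y : EuclideanSpace ℝ (Fin n)) : ℝ :=
  ∫ x : ℝ, (1 + x ^ 2) ^ σ * ‖f (x, y)‖ ^ 2

theorem sliceWeight_nonneg (f : L2 n) (y : EuclideanSpace ℝ (Fin n)) :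
    0 ≤ sliceWeight σ f y :=
  integral_nonneg fun x => by positivity

theorem MemX.integrable_prod {f : L2 n} (hf : MemX σ f) :
    Integrable (fun x : Space n => (1 + x.1 ^ 2) ^ σ * ‖f x‖ ^ 2)
      ((volume : Measure ℝ).prod volume) := hf

theorem MemX.integrable_sliceWeight {f : L2 n} (hf : MemX σ f) :
    Integrable (sliceWeight σ f) :=
  hf.integrable_prod.integral_prod_right

theorem MemX.integral_sliceWeight {f : L2 n} (hf : MemX σ f) :
    √(∫ y, sliceWeight σ f y) = normX σ f :=
  congrArg Real.sqrt (integral_prod_symm _ hf.integrable_prod).symm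

theorem MemX.slice {f : L2 n} (hσ : 1 / 2 < σ) (hf : MemX σ f) :
    ∀ᵐ y, Integrable (fun x : ℝ => f (x, y)) ∧
      ∫ x : ℝ, ‖f (x, y)‖ ≤ √(weightConst σ) * √(sliceWeight σ f y) := by
  filter_upwards [hf.integrable_prod.prod_left_ae] with y hy
  exact integrable_and_integral_norm_le_of_weight hσ
    ((Lp.stronglyMeasurable f).comp_measurable (by fun_prop)).aestronglyMeasurable hy

theorem MemX.memLp_sqrt_sliceWeight {f : L2 n} (hf : MemX σ f) :
    MemLp (fun y => √(sliceWeight σ f y)) 2 := by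
  rw [memLp_two_iff_integrable_sq
    (Real.continuous_sqrt.comp_aestronglyMeasurable hf.integrable_sliceWeight.1)]
  simpa only [Real.sq_sqrt (sliceWeight_nonneg f _)] using hf.integrable_sliceWeight

/-- The slice `L¹` norms are dominated by a multiple of `√(sliceWeight σ f y)`, which is in `L²` of
`y`, hence locally integrable. -/
theorem MemX.partialFourierL2_coeFn {f : L2 n} (hσ : 1 / 2 < σ) (hf : MemX σ f) :
    partialFourierL2 n f =ᵐ[volume] partialFourier f := by
  have h := ShearFlow.partialFourierL2_coeFn (Lp.stronglyMeasurable f) (Lp.memLp f)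
    ((hf.slice hσ).mono fun y hy => hy.1) (by
      have hb : LocallyIntegrable fun y => √(weightConst σ) * √(sliceWeight σ f y) :=
        (hf.memLp_sqrt_sliceWeight.const_mul _).locallyIntegrable (by norm_num)
      refine hb.mono ?_ ?_
      · have hm : StronglyMeasurable fun p : Space n => ‖f p‖ := (Lp.stronglyMeasurable f).norm
        exact hm.integral_prod_left'.aestronglyMeasurable
      · filter_upwards [hf.slice hσ] with y hy
        rw [Real.norm_of_nonneg (integral_nonneg fun x => norm_nonneg _)]
        exact hy.2.trans (le_abs_self _))
  rwa [Lp.toLp_coeFn] at h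

theorem continuous_partialFourier_slice {f : Space n → ℂ} {y : EuclideanSpace ℝ (Fin n)}
    (hf : Integrable fun x : ℝ => f (x, y)) : Continuous fun ξ : ℝ => partialFourier f (ξ, y) :=
  VectorFourier.fourierIntegral_continuous Real.continuous_fourierChar
    (L := innerₗ ℝ) continuous_inner hf

variable {ψ : EuclideanSpace ℝ (Fin n) → ℝ} {ℓ : ℝ} {L : ℝ≥0}

theorem measurable_symbol (hψ : Continuous ψ) : Measurable (symbol ψ) := by
  have : Continuous (symbol ψ) := by
    unfold symbol
    fun_prop
  exact this.measurable

theorem hasDerivAt_inner_cutoff (hσ : 1 / 2 < σ) (hψ : IsRegularShear ψ ℓ L) {f g : L2 n}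
    (hf : MemX σ f) (hg : MemX σ g) (t₀ : ℝ) :
    ∃ D : ℂ, HasDerivAt (fun t : ℝ => inner ℂ g (cutoff (partialFourierL2 n)
        (measurableSet_le (measurable_symbol hψ.continuous) (measurable_const (a := t))) f)) D t₀ ∧
      ‖D‖ ≤ weightConst σ / (2 * Real.pi * ℓ) * normX σ f * normX σ g := by
  have hpos : ∀ y, 0 < ψ y := fun y => hψ.ell_pos.trans (hψ.ell_lt y)
  have hℓ := hψ.ell_pos
  set h : Space n → ℂ := fun p => conj (partialFourier g p) * partialFourier f p with hh
  have hfm := stronglyMeasurable_partialFourier (Lp.stronglyMeasurable f)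
  have hgm := stronglyMeasurable_partialFourier (Lp.stronglyMeasurable g)
  have hhm : StronglyMeasurable h := (Complex.continuous_conj.comp_stronglyMeasurable hgm).mul hfm
  have hint : Integrable h (volume.prod volume) := by
    rw [← Measure.volume_eq_prod]
    exact integrable_conj_mul ((Lp.memLp _).ae_eq (hg.partialFourierL2_coeFn hσ))
      ((Lp.memLp _).ae_eq (hf.partialFourierL2_coeFn hσ))
  have hS : ∀ t, MeasurableSet {p : Space n | symbol ψ p ≤ t} :=
    fun t => measurableSet_le (measurable_symbol hψ.continuous) measurable_const
  have hSint : ∀ t, Integrable ({p : Space n | symbol ψ p ≤ t}.indicator h)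
      (volume.prod volume) := fun t => hint.indicator (hS t)
  have hinner : ∀ t : ℝ, inner ℂ g (cutoff (partialFourierL2 n) (hS t) f) =
      ∫ y, ∫ ξ : ℝ, {p : Space n | symbol ψ p ≤ t}.indicator h (ξ, y) := by
    intro t
    rw [← integral_prod_symm _ (hSint t), ← Measure.volume_eq_prod,
      ← (partialFourierL2 n).inner_map_map, L2.inner_def]
    refine integral_congr_ae ?_
    filter_upwards [cutoff_coeFn (partialFourierL2 n) (hS t) f, hf.partialFourierL2_coeFn hσ,
      hg.partialFourierL2_coeFn hσ] with p h1 h2 h3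
    rw [h1, h3, RCLike.inner_apply]
    by_cases hp : p ∈ {p : Space n | symbol ψ p ≤ t}
    · rw [Set.indicator_of_mem hp, Set.indicator_of_mem hp, h2, mul_comm]
    · rw [Set.indicator_of_notMem hp, Set.indicator_of_notMem hp, zero_mul]
  -- Because `ψ y > 0`, the slice of `{a ≤ t}` at `y` is a half-line in `ξ`.
  have hIic : ∀ t y, ∫ ξ : ℝ, {p : Space n | symbol ψ p ≤ t}.indicator h (ξ, y) =
      ∫ ξ in Set.Iic (t / (2 * Real.pi * ψ y)), h (ξ, y) := by
    intro t y
    rw [← integral_indicator measurableSet_Iic]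
    refine integral_congr_ae (ae_of_all _ fun ξ => ?_)
    have hiff : (ξ, y) ∈ {p : Space n | symbol ψ p ≤ t} ↔
        ξ ∈ Set.Iic (t / (2 * Real.pi * ψ y)) := by
      have := hpos y
      rw [Set.mem_Iic, le_div_iff₀ (by positivity), Set.mem_ofPred_eq, symbol]
      simp only
      rw [show ξ * (2 * Real.pi * ψ y) = 2 * Real.pi * ξ * ψ y by ring]
    change {p : Space n | symbol ψ p ≤ t}.indicator h (ξ, y) = _
    by_cases hp : ξ ∈ Set.Iic (t / (2 * Real.pi * ψ y))
    · rw [Set.indicator_of_mem hp, Set.indicator_of_mem (hiff.2 hp)]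
    · rw [Set.indicator_of_notMem hp, Set.indicator_of_notMem (fun h' => hp (hiff.1 h'))]
  -- The derivative of the slice integral: the integrand at the endpoint `t/(2πψ(y))` times the
  -- speed of the endpoint.
  set F' : ℝ → EuclideanSpace ℝ (Fin n) → ℂ := fun t y =>
    (1 / (2 * Real.pi * ψ y)) • h (t / (2 * Real.pi * ψ y), y) with hF'
  -- Each transform is bounded by the `L¹` norm of its slice, contributing one factor `√(weightConst
  -- σ)`. The bound does not depend on `t`, so it serves for dominated differentiation over all of
  -- `ℝ` and for the final estimate.
  set bd : EuclideanSpace ℝ (Fin n) → ℝ := fun y =>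
    weightConst σ / (2 * Real.pi * ℓ) * (√(sliceWeight σ f y) * √(sliceWeight σ g y)) with hbd
  have hbound : ∀ᵐ y, ∀ t ∈ Set.univ, ‖F' t y‖ ≤ bd y := by
    filter_upwards [hf.slice hσ, hg.slice hσ] with y h1 h2 t _
    have := hpos y
    have e1 : ‖h (t / (2 * Real.pi * ψ y), y)‖ ≤
        (√(weightConst σ) * √(sliceWeight σ g y)) * (√(weightConst σ) * √(sliceWeight σ f y)) := by
      rw [hh]
      simp only [norm_mul, RCLike.norm_conj]
      gcongr
      · exact (norm_partialFourier_le _ _).trans h2.2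
      · exact (norm_partialFourier_le _ _).trans h1.2
    rw [hF', hbd]
    simp only
    rw [norm_smul, Real.norm_of_nonneg (by positivity)]
    calc 1 / (2 * Real.pi * ψ y) * ‖h (t / (2 * Real.pi * ψ y), y)‖
        ≤ 1 / (2 * Real.pi * ℓ) * ((√(weightConst σ) * √(sliceWeight σ g y)) *
          (√(weightConst σ) * √(sliceWeight σ f y))) := by
          gcongr
          exact (hψ.ell_lt y).le
      _ = (√(weightConst σ) * √(weightConst σ)) / (2 * Real.pi * ℓ) *
          (√(sliceWeight σ f y) * √(sliceWeight σ g y)) := by ring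
      _ = _ := by rw [Real.mul_self_sqrt (weightConst_nonneg σ)]
  have hbdint : Integrable bd :=
    (hf.memLp_sqrt_sliceWeight.integrable_mul hg.memLp_sqrt_sliceWeight).const_mul _
  have hψm : Measurable ψ := hψ.continuous.measurable
  have hdiff : ∀ᵐ y, ∀ t ∈ Set.univ,
      HasDerivAt (fun s => ∫ ξ : ℝ, {p : Space n | symbol ψ p ≤ s}.indicator h (ξ, y))
        (F' t y) t := by
    filter_upwards [hf.slice hσ, hg.slice hσ, hint.prod_left_ae] with y h1 h2 h3 t _
    have hc : Continuous fun ξ : ℝ => h (ξ, y) :=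
      (Complex.continuous_conj.comp (continuous_partialFourier_slice h2.1)).mul
        (continuous_partialFourier_slice h1.1)
    simp only [hIic]
    exact (hasDerivAt_integral_Iic hc h3 _).scomp t ((hasDerivAt_id t).div_const _)
  have hmain := (hasDerivAt_integral_of_dominated_loc_of_deriv_le (μ := volume) (x₀ := t₀)
    (F := fun t y => ∫ ξ : ℝ, {p : Space n | symbol ψ p ≤ t}.indicator h (ξ, y))
    (F' := F') Filter.univ_mem
    (Eventually.of_forall fun t => (hSint t).integral_prod_right.1)
    (hSint t₀).integral_prod_right ?_ hbound hbdint hdiff).2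
  · refine ⟨∫ y, F' t₀ y, ?_, ?_⟩
    · simpa only [hinner] using hmain
    · calc ‖∫ y, F' t₀ y‖ ≤ ∫ y, bd y := norm_integral_le_of_norm_le hbdint
            (hbound.mono fun y hy => hy t₀ trivial)
        _ = weightConst σ / (2 * Real.pi * ℓ) *
            ∫ y, √(sliceWeight σ f y) * √(sliceWeight σ g y) := integral_const_mul _ _
        _ ≤ weightConst σ / (2 * Real.pi * ℓ) * (normX σ f * normX σ g) := by
            have := weightConst_nonneg σ
            gcongr
            have h1 := integral_mul_le_sqrt_mul_sqrt (fun y => Real.sqrt_nonneg _)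
              (fun y => Real.sqrt_nonneg _) hf.memLp_sqrt_sliceWeight hg.memLp_sqrt_sliceWeight
            simpa only [Real.sq_sqrt (sliceWeight_nonneg _ _), hf.integral_sliceWeight,
              hg.integral_sliceWeight] using h1
        _ = _ := by ring
  · refine StronglyMeasurable.aestronglyMeasurable ?_
    have hden : Measurable fun y => 2 * Real.pi * ψ y := hψm.const_mul _
    exact (hden.const_div 1).stronglyMeasurable.smul
      (hhm.comp_measurable ((hden.const_div t₀).prodMk measurable_id))

end Derivative

end ShearFlow

end

/-! ### The main theorem -/

theorem mainTheorem3 (σ ℓ : ℝ) (hσ : 1 / 2 < σ) :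
    ∃ C : ℝ, 0 < C ∧
      ∀ (n : ℕ) (ψ : EuclideanSpace ℝ (Fin n) → ℝ) (L : ℝ≥0)
        (hψ : ShearFlow.IsRegularShear ψ ℓ L),
        IsSelfAdjoint (ShearFlow.shearFlow ψ hψ.continuous) ∧
        ∃ E : ℝ → ShearFlow.L2 n →L[ℂ] ShearFlow.L2 n,
          ShearFlow.IsSpectralFamily (ShearFlow.shearFlow ψ hψ.continuous) E ∧
          ∀ f g : ShearFlow.L2 n, ShearFlow.MemX σ f → ShearFlow.MemX σ g → ∀ μ₀ : ℝ,
            DifferentiableAt ℝ (fun μ : ℝ => inner ℂ g (E μ f)) μ₀ ∧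
            ‖deriv (fun μ : ℝ => inner ℂ g (E μ f)) μ₀‖ ≤
              C * (1 + |μ₀| * L / ℓ ^ 2) * ShearFlow.normX σ f * ShearFlow.normX σ g := by
  have hw := ShearFlow.weightConst_nonneg σ
  -- The constant is fixed before `ψ`, when the sign of `ℓ` is still unknown; `|ℓ|` and the added
  -- `1` make it positive in every case.
  refine ⟨ShearFlow.weightConst σ / (2 * Real.pi * |ℓ|) + 1, by positivity, ?_⟩
  intro n ψ L hψ
  obtain ⟨heq, hsa⟩ := ShearFlow.shearFlow_eq_adjoint hψ
  rw [heq]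
  refine ⟨hsa, _, (ShearFlow.isDiagonal_adjoint_shearFlowCore hψ).isSpectralFamily
    (ShearFlow.measurable_symbol hψ.continuous), fun f g hf hg μ₀ => ?_⟩
  obtain ⟨D, hD, hDle⟩ := ShearFlow.hasDerivAt_inner_cutoff hσ hψ hf hg μ₀
  refine ⟨hD.differentiableAt, ?_⟩
  rw [hD.deriv, abs_of_pos hψ.ell_pos]
  refine hDle.trans ?_
  have hℓ := hψ.ell_pos
  have h1 : 0 ≤ ShearFlow.normX σ f := Real.sqrt_nonneg _
  have h2 : 0 ≤ ShearFlow.normX σ g := Real.sqrt_nonneg _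
  have h3 : 0 ≤ |μ₀| * L / ℓ ^ 2 := by positivity
  have h4 : 0 ≤ ShearFlow.weightConst σ / (2 * Real.pi * ℓ) := by positivity
  gcongr
  nlinarith
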